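/- **Setting.** Let $c_2=\big(\sum_{z\in\mathbb Z\setminus\{0\}}|z|^{-3}\big)^{-1}$, $p(z)=c_2|z|^{-3}$ for $z\in\mathbb Z\setminus\{0\}$ and $p(0)=0$. Fix $T>0$, $\kappa>0$, $\alpha,\beta\in[0,1]$ and $\theta\ge 1$. For an integer $N>1$ let $\Lambda_N=\{1,\dots,N-1\}$, $\Omega_N=\{0,1\}^{\Lambda_N}$, $\kappa_N(\theta)=\kappa\log N$ if $\theta=1$ and $\kappa_N(\theta)=\kappa$ if $\theta>1$, and for $\delta\in\{\alpha,\beta\}$ let $c_x(\eta;\delta)=\eta(x)(1-\delta)+(1-\eta(x))\delta$. Let $\sigma^{x,y}\eta$ be $\eta$ with the values at $x$ and $y$ exchanged and $\sigma^x\eta$ be $\eta$ with the value at $x$ flipped. Let $L_N$ act on $f:\Omega_N\to\mathbb R$ by $$(L_Nf)(\eta)=\tfrac12\sum_{x,y\in\Lambda_N}p(x-y)[f(\sigma^{x,y}\eta)-f(\eta)]+\frac{\kappa_N(\theta)}{N^\theta}\sum_{x\in\Lambda_N}\Big(\sum_{y\le 0}p(x-y)c_x(\eta;\alpha)+\sum_{y\ge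 N}p(x-y)c_x(\eta;\beta)\Big)[f(\sigma^x\eta)-f(\eta)].$$ For each $N>1$ let $\mu_N$ be an arbitrary probability measure on $\Omega_N$ and let $(\eta^N_s)_{s\in[0,T]}$ be the càdlàg Markov process on $\Omega_N$ with generator $\frac{N^2}{\log N}L_N$ and initial distribution $\mu_N$; $\mathbb E_{\mu_N}$ denotes expectation with respect to its law. For $x\in\Lambda_N$ put $$\Theta_x^-=\sum_{y\le 0}(x-y)p(x-y),\quad \Theta_x^+=\sum_{y\ge N}(y-x)p(y-x),\quad r_N^-(\tfrac xN)=\sum_{y\ge x}p(y),\quad r_N^+(\tfrac xN)=\sum_{y\le x-N}p(y),$$ and for $\epsilon\in(0,1)$ put $$\overrightarrow\eta^{\epsilon N}_s(0)=\frac1{\lfloor\epsilon N\rfloor}\sum_{x=1}^{\lfloor\epsilon N\rfloor}\eta^N_s(x),\qquad \overleftarrow\eta^{\epsilon N}_s(N)=\frac1{\lfloor\epsilon N\rfloor}\sum_{x=N-\lfloor\epsilon N\rfloor}^{N-1}\eta^N_s(x).$$ **Lemma (Replacement lemma).** For every $t\in[0,T]$ and every $G\in C^\infty([0,1])$, $$\lim_{\epsilon\to0^+}\limsup_{N\to\infty}\mathbb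 E_{\mu_N}\bigg[\Big|\int_0^t\frac1{\log N}\sum_{x\in\Lambda_N}G'(\tfrac xN)\big(\eta_s^N(x)-\overrightarrow\eta_s^{\epsilon N}(0)\big)\Theta_x^-\,ds\Big|\bigg]=0,$$ $$\lim_{\epsilon\to0^+}\limsup_{N\to\infty}\mathbb E_{\mu_N}\bigg[\Big|\int_0^t\frac1{\log N}\sum_{x\in\Lambda_N}G'(\tfrac xN)\big(\eta_s^N(x)-\overleftarrow\eta_s^{\epsilon N}(N)\big)\Theta_x^+\,ds\Big|\bigg]=0,$$ and likewise $$\lim_{\epsilon\to0^+}\limsup_{N\to\infty}\mathbb E_{\mu_N}\bigg[\Big|\int_0^t\sum_{x\in\Lambda_N}G(\tfrac xN)\,r_N^-(\tfrac xN)\big(\eta_s^N(x)-\overrightarrow\eta_s^{\epsilon N}(0)\big)\,ds\Big|\bigg]=0,$$ $$\lim_{\epsilon\to0^+}\limsup_{N\to\infty}\mathbb E_{\mu_N}\bigg[\Big|\int_0^t\sum_{x\in\Lambda_N}G(\tfrac xN)\,r_N^+(\tfrac xN)\big(\eta_s^N(x)-\overleftarrow\eta_s^{\epsilon N}(N)\big)\,ds\Big|\bigg]=0.$$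 -/

import Mathlib

open MeasureTheory Filter Topology Set
open scoped ENNReal

namespace LongJumpExclusion

noncomputable section

/-! ### The jump law -/

/-- The normalizing constant `c₂ = (∑_{z ≠ 0} |z|⁻³)⁻¹`. -/
def c₂ : ℝ := (∑' z : ℤ, if z = 0 then 0 else 1 / |(z : ℝ)| ^ 3)⁻¹

/-- The symmetric jump law `p(z) = c₂ |z|⁻³` for `z ≠ 0`, and `p(0) = 0`. -/
def jumpLaw (z : ℤ) : ℝ := if z = 0 then 0 else c₂ / |(z : ℝ)| ^ 3

/-! ### Configurations -/

/-- The bulk `Λ_N = {1, …, N - 1}`. -/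
abbrev Site (N : ℕ) : Type := ↥(Finset.Ioo (0 : ℤ) (N : ℤ))

/-- The state space `Ω_N = {0,1}^{Λ_N}`; `true` stands for an occupied site. -/
abbrev Config (N : ℕ) : Type := Site N → Bool

/-- The occupation number `η(x) ∈ {0,1}`, as a real number. -/
def occ {N : ℕ} (η : Config N) (x : Site N) : ℝ := if η x then 1 else 0

/-- The configuration `σ^{x,y} η`: the values at `x` and `y` are exchanged. -/
def exchange {N : ℕ} (x y : Site N) (η : Config N) : Config N :=
  fun z => η (Equiv.swap x y z)

/-- The configuration `σ^x η`: the value at `x` is flipped. -/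
def flipAt {N : ℕ} (x : Site N) (η : Config N) : Config N :=
  Function.update η x (!(η x))

/-! ### The generator -/

/-- `κ_N(θ)`: equal to `κ log N` if `θ ∈ {0,1}` and to `κ` otherwise. -/
def kappaN (κ θ : ℝ) (N : ℕ) : ℝ :=
  if θ = 0 ∨ θ = 1 then κ * Real.log N else κ

/-- The rate `c_x(η; δ) = η(x)(1 - δ) + (1 - η(x)) δ`. -/
def flipRate {N : ℕ} (δ : ℝ) (x : Site N) (η : Config N) : ℝ :=
  occ η x * (1 - δ) + (1 - occ η x) * δ

/-- The bulk (exclusion) part `L_N^0` of the generator. -/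
def genBulk {N : ℕ} (f : Config N → ℝ) (η : Config N) : ℝ :=
  1 / 2 * ∑ x : Site N, ∑ y : Site N,
    jumpLaw ((x : ℤ) - (y : ℤ)) * (f (exchange x y η) - f η)

/-- The part `L_N^l` of the generator due to the reservoirs at the sites `y ≤ 0`. -/
def genLeft {N : ℕ} (α κ θ : ℝ) (f : Config N → ℝ) (η : Config N) : ℝ :=
  kappaN κ θ N / (N : ℝ) ^ θ * ∑ x : Site N, ∑' y : Set.Iic (0 : ℤ),
    jumpLaw ((x : ℤ) - (y : ℤ)) * flipRate α x η * (f (flipAt x η) - f η)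

/-- The part `L_N^r` of the generator due to the reservoirs at the sites `y ≥ N`. -/
def genRight {N : ℕ} (β κ θ : ℝ) (f : Config N → ℝ) (η : Config N) : ℝ :=
  kappaN κ θ N / (N : ℝ) ^ θ * ∑ x : Site N, ∑' y : Set.Ici (N : ℤ),
    jumpLaw ((x : ℤ) - (y : ℤ)) * flipRate β x η * (f (flipAt x η) - f η)

/-- The generator `L_N = L_N^0 + L_N^l + L_N^r`. -/
def gen {N : ℕ} (α β κ θ : ℝ) (f : Config N → ℝ) (η : Config N) : ℝ :=
  genBulk f η + genLeft α κ θ f η + genRight β κ θ f η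

/-- The time scale `Θ(N)`. -/
def timeScale (θ : ℝ) (N : ℕ) : ℝ :=
  if θ < 0 then (N : ℝ) ^ (2 + θ) else (N : ℝ) ^ 2 / Real.log N

/-- The matrix (the table of jump rates) of the accelerated generator `Θ(N) L_N`:
its `(η, ξ)` entry is `Θ(N) (L_N 1_{ξ})(η)`. -/
def rateMatrix (N : ℕ) (α β κ θ : ℝ) : Matrix (Config N) (Config N) ℝ :=
  Matrix.of fun η ξ => timeScale θ N * gen α β κ θ (Pi.single ξ (1 : ℝ)) η

/-! ### Continuous-time Markov chains on a finite state space -/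

/-- `X` is, on the time interval `[0,T]`, a càdlàg Markov process on the finite (discrete) state
space `S` with initial distribution `μ` and infinitesimal generator (matrix) `Q`: the paths are
right-continuous with left limits, and the finite-dimensional distributions are those of the
Markov chain started from `μ` with transition semigroup `exp(t Q)`. -/
structure IsMarkovChain {S : Type*} [Fintype S] [DecidableEq S] [MeasurableSpace S]
    (T : ℝ) (Q : Matrix S S ℝ) (μ : Measure S)
    {Ω : Type*} [MeasurableSpace Ω] (P : Measure Ω) (X : ℝ → Ω → S) : Prop where
  measurable : ∀ t ∈ Icc 0 T, Measurable (X t)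
  right_continuous : ∀ w, ∀ t ∈ Ico 0 T, ∀ᶠ s in 𝓝[>] t, X s w = X t w
  left_limits : ∀ w, ∀ t ∈ Ioc 0 T, ∃ η, ∀ᶠ s in 𝓝[<] t, X s w = η
  law : ∀ (n : ℕ) (t : Fin (n + 1) → ℝ), Monotone t → t 0 = 0 → t (Fin.last n) ≤ T →
    ∀ η : Fin (n + 1) → S,
      P.real {w | ∀ i, X (t i) w = η i} =
        μ.real {η 0} *
          ∏ i : Fin n, NormedSpace.exp ((t i.succ - t i.castSucc) • Q) (η i.castSucc) (η i.succ)

/-! ### The quantities in the replacement lemma -/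

/-- The average `(1/⌊εN⌋) ∑_{x=1}^{⌊εN⌋} η(x)` over a box at the left boundary. -/
def leftAvg {N : ℕ} (ε : ℝ) (η : Config N) : ℝ :=
  1 / (⌊ε * N⌋ : ℝ) * ∑ x ∈ Finset.univ.filter (fun x : Site N => (x : ℤ) ≤ ⌊ε * N⌋), occ η x

/-- The average `(1/⌊εN⌋) ∑_{x=N-⌊εN⌋}^{N-1} η(x)` over a box at the right boundary. -/
def rightAvg {N : ℕ} (ε : ℝ) (η : Config N) : ℝ :=
  1 / (⌊ε * N⌋ : ℝ) * ∑ x ∈ Finset.univ.filter (fun x : Site N => (N : ℤ) - ⌊ε * N⌋ ≤ (x : ℤ)), occ η x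

/-- `Θ_x^- = ∑_{y ≤ 0} (x - y) p(x - y)`. -/
def thetaMinus {N : ℕ} (x : Site N) : ℝ :=
  ∑' y : Set.Iic (0 : ℤ), (((x : ℤ) : ℝ) - ((y : ℤ) : ℝ)) * jumpLaw ((x : ℤ) - (y : ℤ))

/-- `Θ_x^+ = ∑_{y ≥ N} (y - x) p(y - x)`. -/
def thetaPlus {N : ℕ} (x : Site N) : ℝ :=
  ∑' y : Set.Ici (N : ℤ), (((y : ℤ) : ℝ) - ((x : ℤ) : ℝ)) * jumpLaw ((y : ℤ) - (x : ℤ))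

/-- `r_N^-(x/N) = ∑_{y ≥ x} p(y)`. -/
def rMinus {N : ℕ} (x : Site N) : ℝ := ∑' y : Set.Ici (x : ℤ), jumpLaw (y : ℤ)

/-- `r_N^+(x/N) = ∑_{y ≤ x - N} p(y)`. -/
def rPlus {N : ℕ} (x : Site N) : ℝ := ∑' y : Set.Iic ((x : ℤ) - (N : ℤ)), jumpLaw (y : ℤ)

/-- The macroscopic position `x/N` of a site. -/
def macroPos {N : ℕ} (x : Site N) : ℝ := ((x : ℤ) : ℝ) / N

/-- The derivative `G'` of a function on `[0,1]` (one-sided at the end points). -/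
def D01 (G : ℝ → ℝ) (u : ℝ) : ℝ := derivWithin G (Icc 0 1) u

end

end LongJumpExclusion

open LongJumpExclusion

/-!
The observables in the four limits have the form `V(η) = ∑ₓ w(x) (η(x) - avg_{εN} η)`, linear in
the occupation numbers, and this makes an elementary proof possible which uses neither relative
entropy nor a Feynman-Kac bound.

*Reduction to first moments.* For a finite Markov chain, `E (∫₀ᵗ V(X_s) ds)²` is twice the integral
of `E[V(X_s) V(X_r)]` over `s ≤ r`. Conditioning on the state at time `s` bounds it by
`2 t ‖V‖_∞ δ`, where `δ` is the supremum over starting states `η` and `U ≤ t` of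
`|∫₀ᵁ (e^{sQ} V)(η) ds|` (`IsMarkovChain.integral_sq_le`). Hence the law of the initial
configuration plays no role.

*Energy.* For fixed `η` and `U`, let `u(x) = ∫₀ᵁ E_η[η_s(x)] ds ∈ [0, U]` be the expected occupation
time. The generator maps occupation numbers to affine functions of occupation numbers (`gen_occ`),
so `u` solves a discrete elliptic equation (`occTime_occ_eq`). Testing it against `u` gives
`∑_{x,y} p(x-y) (u(x) - u(y))² ≤ C log N / N` (`energy_occTime_le`): the factor `log N / N²` is the
inverse of the time scale, and the time derivative as well as the accelerated reservoirs contribute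
`O(N)`, the latter because `θ ≥ 1`.

*From the energy to boundary averages.* Let `E` be the energy of a profile. Nearest-neighbour
increments alone give `|u(x) - u(y)|² ≤ C M E` for `x, y` within distance `M` of the boundary. For
the average over a box of size `ℓ` this would lose a factor `log N`. Walking to the boundary with
steps of length `z` instead bounds the deviation of the average, squared, by `ℓ S_z / z²`, with
`S_z` the sum of the squared increments over distance `z`; weighting by `1 / z` and summing over
`z ≤ M` yields `C ℓ E / log M` (`abs_avg_sub_zero_le`). With `ℓ = εN`, `E = O(log N / N)` and
`M = N / (log N)²` the first error vanishes as `N → ∞` and the second is `O(√ε)`.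

*Weights.* The weights `Θ_x^± / log N` and `r_N^±` have bounded total mass, and the mass they give to
sites at distance more than `M` from the boundary tends to `0`. The right boundary is
treated together with the left one by labelling sites by their distance to the boundary in question
(`BoundaryLabel`).
-/

namespace LongJumpExclusion

/-! ### Boundary averages and the discrete energy -/

/-- If `B` is nonpositive below `z` and grows by at most `d` along steps of length `z`, each increment
`d x` is counted in at most `ℓ / z` of the terms of `∑_{y < ℓ} B y`. -/
lemma sum_le_of_step_le {z : ℕ} (hz : 0 < z) {B d : ℕ → ℝ} (hd : ∀ i, 0 ≤ d i)
    (h0 : ∀ i < z, B i ≤ 0) (ℓ : ℕ) (hstep : ∀ i, i + z < ℓ → B (i + z) ≤ B i + d i) :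
    ∑ i ∈ Finset.range ℓ, B i ≤ (ℓ : ℝ) / z * ∑ i ∈ Finset.range (ℓ - z), d i := by
  have hz' : (0 : ℝ) < z := by exact_mod_cast hz
  induction ℓ using Nat.strong_induction_on with
  | _ ℓ ih =>
    rcases le_or_gt ℓ z with h | h
    · have h1 : ∑ i ∈ Finset.range ℓ, B i ≤ 0 :=
        Finset.sum_nonpos fun i hi => h0 i ((Finset.mem_range.1 hi).trans_le h)
      refine h1.trans (mul_nonneg (by positivity) (Finset.sum_nonneg fun i _ => hd i))
    · obtain ⟨k, rfl⟩ := Nat.exists_eq_add_of_le' h.le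
      have hk := ih k (by omega) fun i hi => hstep i (by omega)
      rw [Nat.add_sub_cancel, add_comm k z, Finset.sum_range_add]
      have h1 : ∑ i ∈ Finset.range z, B i ≤ 0 :=
        Finset.sum_nonpos fun i hi => h0 i (Finset.mem_range.1 hi)
      have h2 : ∑ i ∈ Finset.range k, B (z + i) ≤
          ∑ i ∈ Finset.range k, B i + ∑ i ∈ Finset.range k, d i := by
        rw [← Finset.sum_add_distrib]
        refine Finset.sum_le_sum fun i hi => ?_
        have := Finset.mem_range.1 hi
        rw [add_comm]
        exact hstep i (by omega)
      have h3 : ∑ i ∈ Finset.range (k - z), d i ≤ ∑ i ∈ Finset.range k, d i :=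
        Finset.sum_le_sum_of_subset_of_nonneg
          (Finset.range_mono (Nat.sub_le _ _)) fun i _ _ => hd i
      have h4 : (k : ℝ) / z * ∑ i ∈ Finset.range (k - z), d i ≤
          (k : ℝ) / z * ∑ i ∈ Finset.range k, d i := by gcongr
      have h5 : ((z + k : ℕ) : ℝ) / z = 1 + k / z := by
        push_cast; field_simp
      rw [h5]
      linarith

/-- The square increment sum `∑_i (f(i+z) - f(i))²` over the points `0, …, n - 1`. -/
def sqIncr (n z : ℕ) (f : ℕ → ℝ) : ℝ := ∑ i ∈ Finset.range (n - z), (f (i + z) - f i) ^ 2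

lemma sqIncr_nonneg (n z : ℕ) (f : ℕ → ℝ) : 0 ≤ sqIncr n z f :=
  Finset.sum_nonneg fun _ _ => sq_nonneg _

lemma sqIncr_one_le {n M : ℕ} (hM : 1 ≤ M) (f : ℕ → ℝ) :
    sqIncr n 1 f ≤ ∑ z ∈ Finset.Icc 1 M, sqIncr n z f / (z : ℝ) ^ 3 := by
  have hterm : ∀ z ∈ Finset.Icc 1 M, 0 ≤ sqIncr n z f / (z : ℝ) ^ 3 := fun z _ =>
    div_nonneg (sqIncr_nonneg _ _ _) (by positivity)
  simpa using Finset.single_le_sum hterm (Finset.mem_Icc.2 ⟨le_rfl, hM⟩)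

lemma sum_abs_incr_le {n z ℓ : ℕ} (hℓ : ℓ ≤ n) (f : ℕ → ℝ) :
    ∑ i ∈ Finset.range (ℓ - z), |f (i + z) - f i| ≤ √(ℓ * sqIncr n z f) := by
  refine Real.le_sqrt_of_sq_le ?_
  refine (sq_sum_le_card_mul_sum_sq).trans ?_
  simp only [Finset.card_range, sq_abs]
  refine mul_le_mul (by exact_mod_cast Nat.sub_le _ _) ?_
    (Finset.sum_nonneg fun _ _ => sq_nonneg _) (by positivity)
  exact Finset.sum_le_sum_of_subset_of_nonneg (Finset.range_mono (by omega))
    fun _ _ _ => sq_nonneg _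

lemma abs_sub_zero_le {n M : ℕ} (hM : M ≤ n) (f : ℕ → ℝ) {i : ℕ} (hi : i < M) :
    |f i - f 0| ≤ √(M * sqIncr n 1 f) := by
  refine le_trans ?_ (sum_abs_incr_le hM f)
  rw [← Finset.sum_range_sub]
  refine (Finset.abs_sum_le_sum_abs _ _).trans ?_
  exact Finset.sum_le_sum_of_subset_of_nonneg (Finset.range_mono (by omega))
    fun _ _ _ => abs_nonneg _

/-- Comparison of the average over `ℓ` points with the value at the first point. Every step size
`z ≤ M` gives the same bound in terms of its share `S_z / z³` of the energy `D`; summing over the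
step sizes gains the factor `∑_{z ≤ M} 1 / z ≥ log M`. -/
lemma abs_avg_sub_zero_le {n M ℓ : ℕ} (hM1 : 1 < M) (hM : M ≤ n) (hℓ0 : 0 < ℓ) (hℓ : ℓ ≤ n)
    (f : ℕ → ℝ) {D : ℝ}
    (hD : ∑ z ∈ Finset.Icc 1 M, sqIncr n z f / (z : ℝ) ^ 3 ≤ D) :
    |1 / (ℓ : ℝ) * ∑ i ∈ Finset.range ℓ, f i - f 0| ≤ √(M * D) + √(ℓ * D / Real.log M) := by
  have hℓ' : (0 : ℝ) < ℓ := by exact_mod_cast hℓ0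
  have hlog : 0 < Real.log M := Real.log_pos (by exact_mod_cast hM1)
  have hS1 : sqIncr n 1 f ≤ D := (sqIncr_one_le hM1.le f).trans hD
  set τ := √(M * D) with hτ
  have hτle : ∀ i < M, |f i - f 0| ≤ τ := fun i hi =>
    (abs_sub_zero_le hM f hi).trans (Real.sqrt_le_sqrt (by gcongr))
  set A := 1 / (ℓ : ℝ) * ∑ i ∈ Finset.range ℓ, |f i - f 0| with hA
  have hle : |1 / (ℓ : ℝ) * ∑ i ∈ Finset.range ℓ, f i - f 0| ≤ A := by
    have : 1 / (ℓ : ℝ) * ∑ i ∈ Finset.range ℓ, f i - f 0 =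
        1 / (ℓ : ℝ) * ∑ i ∈ Finset.range ℓ, (f i - f 0) := by
      rw [Finset.sum_sub_distrib]
      simp
      field_simp
    rw [this, abs_mul, abs_of_pos (by positivity : 0 < 1 / (ℓ : ℝ)), hA]
    gcongr
    exact Finset.abs_sum_le_sum_abs _ _
  -- only the part of the deviation above the pointwise error `τ` has to be estimated
  suffices h : A - τ ≤ √(ℓ * D / Real.log M) by linarith
  rcases le_or_gt (A - τ) 0 with h0 | h0
  · exact h0.trans (Real.sqrt_nonneg _)
  refine Real.le_sqrt_of_sq_le ?_
  rw [le_div_iff₀ hlog]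
  have hz : ∀ z ∈ Finset.Icc 1 M, (A - τ) ^ 2 * (z : ℝ)⁻¹ ≤ ℓ * (sqIncr n z f / (z : ℝ) ^ 3) := by
    intro z hz
    obtain ⟨hz1, hzM⟩ := Finset.mem_Icc.1 hz
    have hz' : (0 : ℝ) < z := by exact_mod_cast hz1
    have h1 := sum_le_of_step_le (z := z) hz1 (B := fun i => |f i - f 0| - τ)
      (d := fun i => |f (i + z) - f i|) (fun i => abs_nonneg _)
      (fun i hi => sub_nonpos.2 (hτle i (by omega))) ℓ (fun i _ => by
        have := abs_sub_le (f (i + z)) (f i) (f 0)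
        linarith)
    have h2 : ∑ i ∈ Finset.range ℓ, (|f i - f 0| - τ) = ℓ * (A - τ) := by
      rw [Finset.sum_sub_distrib, hA]
      simp
      field_simp
    rw [h2] at h1
    have h3 : (ℓ : ℝ) * (A - τ) ≤ ℓ / z * √(ℓ * sqIncr n z f) :=
      h1.trans (mul_le_mul_of_nonneg_left (sum_abs_incr_le hℓ f) (by positivity))
    have h4 : z * (A - τ) ≤ √(ℓ * sqIncr n z f) := by
      have : (ℓ : ℝ) / z * (z * (A - τ)) ≤ ℓ / z * √(ℓ * sqIncr n z f) := by
        convert h3 using 1; field_simp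
      exact le_of_mul_le_mul_left this (by positivity)
    have h5 : (z * (A - τ)) ^ 2 ≤ ℓ * sqIncr n z f := by
      have := pow_le_pow_left₀ (by positivity) h4 2
      rwa [Real.sq_sqrt (mul_nonneg (by positivity) (sqIncr_nonneg _ _ _))] at this
    have : (A - τ) ^ 2 * (z : ℝ)⁻¹ = (z * (A - τ)) ^ 2 / (z : ℝ) ^ 3 := by field_simp
    rw [this, ← mul_div_assoc]
    gcongr
  have hlogle : Real.log M ≤ ∑ z ∈ Finset.Icc 1 M, (z : ℝ)⁻¹ := by
    have h1 := log_add_one_le_harmonic M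
    rw [harmonic_eq_sum_Icc] at h1
    push_cast at h1
    refine le_trans (Real.log_le_log (by positivity) ?_) h1
    linarith
  calc (A - τ) ^ 2 * Real.log M ≤ (A - τ) ^ 2 * ∑ z ∈ Finset.Icc 1 M, (z : ℝ)⁻¹ := by gcongr
    _ = ∑ z ∈ Finset.Icc 1 M, (A - τ) ^ 2 * (z : ℝ)⁻¹ := Finset.mul_sum _ _ _
    _ ≤ ∑ z ∈ Finset.Icc 1 M, ℓ * (sqIncr n z f / (z : ℝ) ^ 3) := Finset.sum_le_sum hz
    _ = ℓ * ∑ z ∈ Finset.Icc 1 M, sqIncr n z f / (z : ℝ) ^ 3 := (Finset.mul_sum _ _ _).symm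
    _ ≤ ℓ * D := by gcongr

/-- The replacement estimate for one function `f`: the weights near the boundary see `f` within
`O(√(M D))` of its value at the first point, the remaining weights are paid for by `0 ≤ f ≤ U`. -/
lemma abs_sum_weight_mul_sub_avg_le {n M ℓ : ℕ} (hM1 : 1 < M) (hM : M ≤ n) (hℓ0 : 0 < ℓ)
    (hℓ : ℓ ≤ n) (f : ℕ → ℝ) {D U : ℝ} (hf : ∀ i < n, f i ∈ Icc 0 U)
    (hD : ∑ z ∈ Finset.Icc 1 M, sqIncr n z f / (z : ℝ) ^ 3 ≤ D) (w : ℕ → ℝ) :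
    |∑ i ∈ Finset.range n, w i * (f i - 1 / (ℓ : ℝ) * ∑ j ∈ Finset.range ℓ, f j)| ≤
      (∑ i ∈ Finset.range n, |w i|) * (2 * √(M * D) + √(ℓ * D / Real.log M)) +
        U * ∑ i ∈ (Finset.range n).filter (fun i => M ≤ i), |w i| := by
  set a := 1 / (ℓ : ℝ) * ∑ j ∈ Finset.range ℓ, f j with ha
  have hℓ' : (0 : ℝ) < ℓ := by exact_mod_cast hℓ0
  have ha0 : 0 ≤ a := mul_nonneg (by positivity) (Finset.sum_nonneg fun j hj =>
    (hf j ((Finset.mem_range.1 hj).trans_le hℓ)).1)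
  have haU : a ≤ U := by
    have : ∑ j ∈ Finset.range ℓ, f j ≤ ℓ * U := by
      refine (Finset.sum_le_sum (g := fun _ => U) fun j hj =>
        (hf j ((Finset.mem_range.1 hj).trans_le hℓ)).2).trans ?_
      simp
    rw [ha, one_div, inv_mul_le_iff₀ hℓ']
    exact this
  have hb := abs_avg_sub_zero_le hM1 hM hℓ0 hℓ f hD
  rw [← ha] at hb
  have hS1 : sqIncr n 1 f ≤ D := (sqIncr_one_le hM1.le f).trans hD
  refine (Finset.abs_sum_le_sum_abs _ _).trans ?_
  simp only [abs_mul]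
  rw [Finset.sum_mul, Finset.mul_sum, Finset.sum_filter, ← Finset.sum_add_distrib]
  refine Finset.sum_le_sum fun i hi => ?_
  have hin := Finset.mem_range.1 hi
  have hpos : 0 ≤ |w i| * (2 * √(M * D) + √(ℓ * D / Real.log M)) := by positivity
  split_ifs with h
  · have : |f i - a| ≤ U := by
      have := hf i hin
      rw [abs_le]; constructor <;> linarith [this.1, this.2]
    nlinarith [abs_nonneg (w i)]
  · have h1 : |f i - f 0| ≤ √(M * D) :=
      (abs_sub_zero_le hM f (by omega)).trans (Real.sqrt_le_sqrt (by gcongr))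
    have h2 := abs_sub_le (f i) (f 0) a
    rw [abs_sub_comm (f 0) a] at h2
    rw [add_zero]
    gcongr
    linarith

/-! ### The semigroup of a finite rate matrix -/

section Semigroup

variable {S : Type*} [Fintype S] [DecidableEq S]

open scoped Matrix

open scoped Matrix.Norms.Operator in
lemma hasDerivAt_exp_smul_mulVec (Q : Matrix S S ℝ) (g : S → ℝ) (η : S) (s : ℝ) :
    HasDerivAt (fun s : ℝ => (NormedSpace.exp (s • Q) *ᵥ g) η)
      ((NormedSpace.exp (s • Q) *ᵥ (Q *ᵥ g)) η) s := by
  have h := hasDerivAt_exp_smul_const (𝕂 := ℝ) Q s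
  let φ : Matrix S S ℝ →ₗ[ℝ] ℝ :=
    { toFun := fun A => (A *ᵥ g) η
      map_add' := fun A B => by simp [Matrix.add_mulVec]
      map_smul' := fun c A => by simp [Matrix.smul_mulVec] }
  have h2 := (LinearMap.toContinuousLinearMap φ).hasFDerivAt.comp_hasDerivAt s h
  rw [Matrix.mulVec_mulVec]
  exact h2

lemma continuous_exp_smul_mulVec (Q : Matrix S S ℝ) (g : S → ℝ) (η : S) :
    Continuous fun s : ℝ => (NormedSpace.exp (s • Q) *ᵥ g) η :=
  continuous_iff_continuousAt.2 fun s => (hasDerivAt_exp_smul_mulVec Q g η s).continuousAt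

lemma integral_exp_smul_mulVec (Q : Matrix S S ℝ) (g : S → ℝ) (η : S) (U : ℝ) :
    ∫ s in (0 : ℝ)..U, (NormedSpace.exp (s • Q) *ᵥ (Q *ᵥ g)) η =
      (NormedSpace.exp (U • Q) *ᵥ g) η - g η := by
  rw [intervalIntegral.integral_eq_sub_of_hasDerivAt
    (fun s _ => hasDerivAt_exp_smul_mulVec Q g η s)
    ((continuous_exp_smul_mulVec Q _ η).intervalIntegrable _ _)]
  simp

lemma exp_smul_mulVec_one {Q : Matrix S S ℝ} (hQ : Q *ᵥ 1 = 0) (s : ℝ) :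
    NormedSpace.exp (s • Q) *ᵥ 1 = 1 := by
  funext η
  have h := integral_exp_smul_mulVec Q 1 η s
  rw [hQ] at h
  simp only [Matrix.mulVec_zero, Pi.zero_apply, intervalIntegral.integral_zero] at h
  linarith

open scoped Matrix.Norms.Operator in
lemma exp_nonneg_of_nonneg {A : Matrix S S ℝ} (hA : ∀ i j, 0 ≤ A i j) (i j : S) :
    0 ≤ NormedSpace.exp A i j := by
  have h := NormedSpace.exp_series_hasSum_exp' (𝕂 := ℝ) A
  have hpow : ∀ n : ℕ, ∀ i j, 0 ≤ (A ^ n) i j := by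
    intro n
    induction n with
    | zero => intro i j; rw [pow_zero, Matrix.one_apply]; split_ifs <;> norm_num
    | succ n ih =>
      intro i j
      rw [pow_succ, Matrix.mul_apply]
      exact Finset.sum_nonneg fun k _ => mul_nonneg (ih i k) (hA k j)
  let φ : Matrix S S ℝ →ₗ[ℝ] ℝ :=
    { toFun := fun A => A i j, map_add' := fun A B => rfl, map_smul' := fun c A => rfl }
  have h2 := h.mapL (LinearMap.toContinuousLinearMap φ)
  exact h2.nonneg fun n => mul_nonneg (by positivity) (hpow n i j)

/-- The semigroup of a matrix with nonnegative off-diagonal entries is nonnegative: shift the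
diagonal by a multiple of the identity, which commutes with everything. -/
lemma exp_smul_nonneg {Q : Matrix S S ℝ} (hQ : ∀ i j, i ≠ j → 0 ≤ Q i j) {s : ℝ} (hs : 0 ≤ s)
    (i j : S) : 0 ≤ NormedSpace.exp (s • Q) i j := by
  obtain ⟨c, hc⟩ : ∃ c : ℝ, ∀ i, -c ≤ Q i i :=
    ⟨∑ k, |Q k k|, fun i => by
      have := Finset.single_le_sum (f := fun k => |Q k k|) (fun k _ => abs_nonneg _)
        (Finset.mem_univ i)
      linarith [neg_abs_le (Q i i)]⟩
  have hdec : s • Q = s • (Q + Matrix.diagonal fun _ => c) + Matrix.diagonal fun _ => -(s * c) := by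
    ext a b
    by_cases h : a = b
    · subst h; simp
    · simp [h]
  have hcomm : Commute (s • (Q + Matrix.diagonal fun _ => c))
      (Matrix.diagonal fun _ => -(s * c)) := by
    have : (Matrix.diagonal fun _ : S => -(s * c)) = Matrix.scalar S (-(s * c)) := rfl
    rw [this]
    exact (Matrix.scalar_commute _ (fun r => Commute.all _ _) _).symm
  rw [hdec, Matrix.exp_add_of_commute _ _ hcomm, Matrix.exp_diagonal, Matrix.mul_diagonal]
  refine mul_nonneg (exp_nonneg_of_nonneg (fun a b => ?_) i j) ?_
  · by_cases h : a = b
    · subst h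
      simp only [Matrix.smul_apply, Matrix.add_apply, Matrix.diagonal_apply_eq, smul_eq_mul]
      exact mul_nonneg hs (by linarith [hc a])
    · simpa [h] using mul_nonneg hs (hQ a b h)
  · rw [Pi.coe_exp, ← Real.exp_eq_exp_ℝ]
    exact (Real.exp_pos _).le

/-- The semigroup preserves the bounds `0 ≤ g ≤ 1`. -/
lemma exp_smul_mulVec_mem_Icc {Q : Matrix S S ℝ} (hQ : ∀ i j, i ≠ j → 0 ≤ Q i j)
    (hQ1 : Q *ᵥ 1 = 0) {s : ℝ} (hs : 0 ≤ s) {g : S → ℝ} (hg : ∀ η, g η ∈ Icc (0 : ℝ) 1) (η : S) :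
    (NormedSpace.exp (s • Q) *ᵥ g) η ∈ Icc (0 : ℝ) 1 := by
  have hone : (NormedSpace.exp (s • Q) *ᵥ 1) η = 1 := by rw [exp_smul_mulVec_one hQ1]; rfl
  have hnn := exp_smul_nonneg hQ hs
  refine ⟨Finset.sum_nonneg fun k _ => mul_nonneg (hnn η k) (hg k).1, ?_⟩
  rw [← hone]
  exact Finset.sum_le_sum fun k _ => mul_le_mul_of_nonneg_left (hg k).2 (hnn η k)

end Semigroup

/-! ### Time integrals along a finite Markov chain -/

section MarkovChain

open scoped Matrix

variable {S : Type*} [Fintype S] [MeasurableSpace S] [MeasurableSingletonClass S]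
  {Ω : Type*} [MeasurableSpace Ω] {P : Measure Ω} {X : ℝ → Ω → S}

lemma real_eq_sum_inter_preimage [IsFiniteMeasure P] {Y : Ω → S} (hY : Measurable Y) (A : Set Ω) :
    P.real A = ∑ a, P.real ({w | Y w = a} ∩ A) := by
  have h := sum_measureReal_preimage_singleton (μ := P.restrict A) (f := Y) Finset.univ
    (fun y _ => hY (measurableSet_singleton y))
  simp only [Finset.coe_univ, preimage_univ] at h
  rw [measureReal_restrict_apply_univ] at h
  rw [← h]
  exact Finset.sum_congr rfl fun a _ =>
    (measureReal_restrict_apply (hY (measurableSet_singleton a)))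

/-- A right-continuous process with values in a finite space is jointly measurable. -/
lemma measurable_uncurry_of_rightContinuous {Y : ℝ → Ω → S} (hm : ∀ s, Measurable (Y s))
    (hY : ∀ s w, ∀ᶠ u in 𝓝[>] s, Y u w = Y s w) (V : S → ℝ) :
    Measurable fun z : ℝ × Ω => V (Y z.1 z.2) := by
  have hV : Measurable V := Measurable.of_discrete
  -- approximate from the right by processes that are constant in time on intervals of length `1 / (n + 1)`
  refine measurable_of_tendsto_metrizable
    (f := fun (n : ℕ) (z : ℝ × Ω) => V (Y ((⌊z.1 * (n + 1)⌋ + 1 : ℝ) / (n + 1)) z.2)) ?_ ?_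
  · intro n
    have h : Measurable fun z : ℤ × Ω => V (Y ((z.1 + 1 : ℝ) / (n + 1)) z.2) :=
      measurable_from_prod_countable_right fun k =>
        hV.comp (hm ((k + 1 : ℝ) / (n + 1)))
    have h2 : Measurable fun z : ℝ × Ω => ((⌊z.1 * ((n : ℝ) + 1)⌋, z.2) : ℤ × Ω) :=
      (Int.measurable_floor.comp (measurable_fst.mul_const _)).prodMk measurable_snd
    exact h.comp h2
  · rw [tendsto_pi_nhds]
    rintro ⟨s, w⟩
    have hgt : ∀ n : ℕ, s < (⌊s * (n + 1)⌋ + 1 : ℝ) / (n + 1) := fun n => by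
      rw [lt_div_iff₀ (by positivity)]
      exact Int.lt_floor_add_one _
    have hle : ∀ n : ℕ, (⌊s * (n + 1)⌋ + 1 : ℝ) / (n + 1) ≤ s + 1 / ((n : ℝ) + 1) := fun n => by
      rw [div_le_iff₀ (by positivity), add_mul, one_div, inv_mul_cancel₀ (by positivity)]
      linarith [Int.floor_le (s * ((n : ℝ) + 1))]
    have hlim : Tendsto (fun n : ℕ => (⌊s * (n + 1)⌋ + 1 : ℝ) / (n + 1)) atTop (𝓝[>] s) := by
      refine tendsto_nhdsWithin_iff.2 ⟨?_, Eventually.of_forall hgt⟩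
      refine tendsto_of_tendsto_of_tendsto_of_le_of_le tendsto_const_nhds ?_
        (fun n => (hgt n).le) hle
      simpa using tendsto_const_nhds.add (tendsto_one_div_add_atTop_nhds_zero_nat (𝕜 := ℝ))
    refine tendsto_const_nhds.congr' ?_
    filter_upwards [hlim.eventually (hY s w)] with n hn
    simp only [hn]

variable [DecidableEq S] {T : ℝ} {Q : Matrix S S ℝ} {μ : Measure S}

/-- The Markov property for the joint law at two times. -/
lemma IsMarkovChain.real_pair [IsFiniteMeasure P] (hX : IsMarkovChain T Q μ P X) {s r : ℝ}
    (hs : 0 ≤ s) (hsr : s ≤ r) (hr : r ≤ T) (a b : S) :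
    P.real {w | X s w = a ∧ X r w = b} =
      P.real {w | X s w = a} * NormedSpace.exp ((r - s) • Q) a b := by
  have h0 : Measurable (X 0) := hX.measurable 0 ⟨le_rfl, hs.trans (hsr.trans hr)⟩
  rw [real_eq_sum_inter_preimage h0 {w | X s w = a ∧ X r w = b},
    real_eq_sum_inter_preimage h0 {w | X s w = a}, Finset.sum_mul]
  refine Finset.sum_congr rfl fun e _ => ?_
  have h2 := hX.law 2 ![0, s, r] (by
    intro i j hij
    have := hs.trans hsr
    fin_cases i <;> fin_cases j <;> simp_all) rfl (by simpa [Fin.last] using hr) ![e, a, b]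
  have h1 := hX.law 1 ![0, s] (by
    intro i j hij
    fin_cases i <;> fin_cases j <;> simp_all) rfl (by simpa [Fin.last] using hsr.trans hr) ![e, a]
  have e2 : {w | ∀ i, X ((![0, s, r] : Fin 3 → ℝ) i) w = (![e, a, b] : Fin 3 → S) i} =
      {w | X 0 w = e} ∩ {w | X s w = a ∧ X r w = b} := by
    ext w; simp [Fin.forall_fin_succ]
  have e1 : {w | ∀ i, X ((![0, s] : Fin 2 → ℝ) i) w = (![e, a] : Fin 2 → S) i} =
      {w | X 0 w = e} ∩ {w | X s w = a} := by
    ext w; simp [Fin.forall_fin_succ]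
  rw [e2] at h2
  rw [e1] at h1
  rw [h2, h1]
  simp [Fin.prod_univ_succ]
  ring

lemma IsMarkovChain.integral_mul [IsFiniteMeasure P] (hX : IsMarkovChain T Q μ P X) {s r : ℝ}
    (hs : 0 ≤ s) (hsr : s ≤ r) (hr : r ≤ T) (V : S → ℝ) :
    ∫ w, V (X s w) * V (X r w) ∂P =
      ∑ a, P.real {w | X s w = a} * (V a * (NormedSpace.exp ((r - s) • Q) *ᵥ V) a) := by
  have hms : Measurable (X s) := hX.measurable s ⟨hs, hsr.trans hr⟩
  have hmr : Measurable (X r) := hX.measurable r ⟨hs.trans hsr, hr⟩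
  have hm : Measurable fun w => (X s w, X r w) := hms.prodMk hmr
  have h1 : ∫ w, V (X s w) * V (X r w) ∂P =
      ∫ z, V z.1 * V z.2 ∂(P.map fun w => (X s w, X r w)) := by
    rw [integral_map hm.aemeasurable (Measurable.of_discrete).aestronglyMeasurable]
  rw [h1, integral_fintype (Integrable.of_finite), Fintype.sum_prod_type]
  refine Finset.sum_congr rfl fun a _ => ?_
  rw [Matrix.mulVec, dotProduct, Finset.mul_sum, Finset.mul_sum]
  refine Finset.sum_congr rfl fun b _ => ?_
  rw [map_measureReal_apply hm (measurableSet_singleton _)]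
  have : (fun w => (X s w, X r w)) ⁻¹' {(a, b)} = {w | X s w = a ∧ X r w = b} := by
    ext w; simp
  rw [this, hX.real_pair hs hsr hr]
  simp only [smul_eq_mul]
  ring

/-- The second moment of a time integral is controlled by the first moments of the time integrals
started from deterministic states: write the square as twice the integral over `s ≤ r` and
condition on the state at time `s`. -/
lemma IsMarkovChain.integral_sq_le [IsProbabilityMeasure P] (hX : IsMarkovChain T Q μ P X)
    {t : ℝ} (ht : t ∈ Icc 0 T) (V : S → ℝ) {K δ : ℝ} (hK : ∀ a, |V a| ≤ K)
    (hδ : ∀ a, ∀ u ∈ Icc 0 t, |∫ s in (0 : ℝ)..u, (NormedSpace.exp (s • Q) *ᵥ V) a| ≤ δ) :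
    AEStronglyMeasurable (fun w => ∫ s in (0 : ℝ)..t, V (X s w)) P ∧
    (∀ w, |∫ s in (0 : ℝ)..t, V (X s w)| ≤ K * t) ∧
    ∫ w, (∫ s in (0 : ℝ)..t, V (X s w)) ^ 2 ∂P ≤ 2 * t * K * δ := by
  obtain ⟨ht0, htT⟩ := ht
  have hne : Nonempty S := by
    obtain ⟨w⟩ := nonempty_of_isProbabilityMeasure P
    exact ⟨X 0 w⟩
  have hK0 : 0 ≤ K := (abs_nonneg _).trans (hK hne.some)
  -- the process, frozen outside `[0, t]`
  set Y : ℝ → Ω → S := fun s w => X (max 0 (min s t)) w with hYdef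
  have hYX : ∀ s ∈ Ioc 0 t, Y s = X s := fun s hs => by
    simp [hYdef, min_eq_left hs.2, max_eq_right hs.1.le]
  have hYm : ∀ s, Measurable (Y s) := fun s =>
    hX.measurable _ ⟨le_max_left _ _, max_le (ht0.trans htT) ((min_le_right _ _).trans htT)⟩
  have hYr : ∀ s w, ∀ᶠ u in 𝓝[>] s, Y u w = Y s w := by
    intro s w
    rcases le_or_gt t s with h | h
    · filter_upwards [self_mem_nhdsWithin] with u hu
      have hu : s < u := hu
      simp [hYdef, min_eq_right h, min_eq_right (h.trans hu.le)]
    rcases lt_or_ge s 0 with h' | h'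
    · filter_upwards [nhdsWithin_le_nhds (Iio_mem_nhds h')] with u hu
      have hu : u < 0 := hu
      have h1 : min u t ≤ 0 := (min_le_left _ _).trans hu.le
      have h2 : min s t ≤ 0 := (min_le_left _ _).trans h'.le
      simp [hYdef, max_eq_left h1, max_eq_left h2]
    · filter_upwards [self_mem_nhdsWithin, nhdsWithin_le_nhds (Iio_mem_nhds h),
        hX.right_continuous w s ⟨h', h.trans_le htT⟩] with u hu hut hXu
      have hu : s < u := hu
      have hut : u < t := hut
      simp only [hYdef, min_eq_left hut.le, min_eq_left h.le, max_eq_right h',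
        max_eq_right (h'.trans hu.le), hXu]
  have hv := measurable_uncurry_of_rightContinuous hYm hYr V
  set ν : Measure ℝ := volume.restrict (Ioc 0 t) with hν
  have hint : ∀ w, ∫ s in (0 : ℝ)..t, V (X s w) = ∫ s, V (Y s w) ∂ν := fun w => by
    rw [intervalIntegral.integral_of_le ht0]
    exact setIntegral_congr_fun measurableSet_Ioc fun s hs => by simp only [hYX s hs]
  have hνuniv : ν.real univ = t := by simp [hν, measureReal_def, ht0]
  simp only [hint]
  refine ⟨?_, fun w => ?_, ?_⟩
  · exact (hv.stronglyMeasurable.integral_prod_left (μ := ν)).aestronglyMeasurable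
  · have := norm_integral_le_of_norm_le_const (μ := ν) (f := fun s => V (Y s w)) (C := K)
      (Eventually.of_forall fun s => hK _)
    rwa [hνuniv] at this
  set φ : ℝ × ℝ → ℝ := fun z => ∫ w, V (Y z.1 w) * V (Y z.2 w) ∂P with hφ
  have hF : Measurable fun q : (ℝ × ℝ) × Ω => V (Y q.1.1 q.2) * V (Y q.1.2 q.2) :=
    (hv.comp ((measurable_fst.comp measurable_fst).prodMk measurable_snd)).mul
      (hv.comp ((measurable_snd.comp measurable_fst).prodMk measurable_snd))
  have hbd : ∀ s r w, ‖V (Y s w) * V (Y r w)‖ ≤ K * K := fun s r w => by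
    rw [norm_mul]
    exact mul_le_mul (hK _) (hK _) (norm_nonneg _) hK0
  have hFint : Integrable (Function.uncurry fun (w : Ω) (z : ℝ × ℝ) =>
      V (Y z.1 w) * V (Y z.2 w)) (P.prod (ν.prod ν)) :=
    Integrable.of_bound (hF.comp measurable_swap).aestronglyMeasurable (K * K)
      (Eventually.of_forall fun q => hbd _ _ _)
  have hφm : StronglyMeasurable φ := hF.stronglyMeasurable.integral_prod_right (ν := P)
  have hφbd : ∀ z, ‖φ z‖ ≤ K * K := fun z => by
    have := norm_integral_le_of_norm_le_const (μ := P)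
      (Eventually.of_forall fun w => hbd z.1 z.2 w)
    simpa using this
  have hφint : Integrable φ (ν.prod ν) := Integrable.of_bound hφm.aestronglyMeasurable (K * K)
      (Eventually.of_forall hφbd)
  have hsq : ∫ w, (∫ s, V (Y s w) ∂ν) ^ 2 ∂P = ∫ z, φ z ∂(ν.prod ν) := by
    rw [hφ, ← integral_integral_swap hFint]
    refine integral_congr_ae (Eventually.of_forall fun w => ?_)
    simp only
    rw [sq, ← integral_prod_mul]
  -- the inner integral over the times after `s`
  have hinner : ∀ s ∈ Ioc 0 t, |∫ r in Ioc s t, φ (s, r)| ≤ K * δ := by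
    intro s hs
    have h1 : ∫ r in Ioc s t, φ (s, r) = ∫ r in s..t, ∑ a, P.real {w | X s w = a} *
        (V a * (NormedSpace.exp ((r - s) • Q) *ᵥ V) a) := by
      rw [intervalIntegral.integral_of_le hs.2]
      refine setIntegral_congr_fun measurableSet_Ioc fun r hr => ?_
      simp only [hφ]
      rw [hYX s hs, hYX r ⟨hs.1.trans hr.1, hr.2⟩]
      exact hX.integral_mul hs.1.le hr.1.le (hr.2.trans htT) V
    have hc : ∀ a, Continuous fun r : ℝ => (NormedSpace.exp ((r - s) • Q) *ᵥ V) a := fun a =>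
      (continuous_exp_smul_mulVec Q V a).comp (continuous_id.sub continuous_const)
    have hi : ∀ a ∈ Finset.univ, IntervalIntegrable (fun r => P.real {w | X s w = a} *
        (V a * (NormedSpace.exp ((r - s) • Q) *ᵥ V) a)) volume s t := fun a _ =>
      (continuous_const.mul (continuous_const.mul (hc a))).intervalIntegrable _ _
    rw [h1, intervalIntegral.integral_finsetSum hi]
    refine (Finset.abs_sum_le_sum_abs _ _).trans ?_
    have h2 : ∑ a, P.real {w | X s w = a} = 1 := by
      have := real_eq_sum_inter_preimage (P := P)
        (hX.measurable s ⟨hs.1.le, hs.2.trans htT⟩) univ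
      simpa using this.symm
    have h3 : ∀ a ∈ Finset.univ, |∫ r in s..t, P.real {w | X s w = a} *
        (V a * (NormedSpace.exp ((r - s) • Q) *ᵥ V) a)| ≤ P.real {w | X s w = a} * (K * δ) := by
      intro a _
      rw [intervalIntegral.integral_const_mul, intervalIntegral.integral_const_mul, abs_mul,
        abs_mul, abs_of_nonneg measureReal_nonneg]
      rw [intervalIntegral.integral_comp_sub_right
        (fun r => (NormedSpace.exp (r • Q) *ᵥ V) a) s, sub_self]
      gcongr
      · exact hK a
      · exact hδ a _ ⟨sub_nonneg.2 hs.2, by linarith [hs.1]⟩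
    refine (Finset.sum_le_sum h3).trans ?_
    rw [← Finset.sum_mul, h2, one_mul]
  have hhalf : ∀ A : Set (ℝ × ℝ), MeasurableSet A →
      (∀ s ∈ Ioc 0 t, volume.restrict ((Prod.mk s ⁻¹' A) ∩ Ioc 0 t) = volume.restrict (Ioc s t)) →
      ∫ z, A.indicator φ z ∂(ν.prod ν) ≤ t * (K * δ) := by
    intro A hA hAs
    rw [integral_prod _ (hφint.indicator hA)]
    refine (le_abs_self _).trans ?_
    have h := norm_integral_le_of_norm_le_const (μ := ν)
      (f := fun s => ∫ r, A.indicator φ (s, r) ∂ν) (C := K * δ) (by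
        refine (ae_restrict_mem measurableSet_Ioc).mono fun s hs => ?_
        have hAm : MeasurableSet (Prod.mk s ⁻¹' A) := measurable_prodMk_left hA
        have e : (fun r => A.indicator φ (s, r)) =
            (Prod.mk s ⁻¹' A).indicator fun r => φ (s, r) := rfl
        rw [e, MeasureTheory.integral_indicator hAm, hν, Measure.restrict_restrict hAm,
          hAs s hs]
        exact hinner s hs)
    rw [hνuniv] at h
    calc _ ≤ _ := h
      _ = _ := mul_comm _ _
  set A : Set (ℝ × ℝ) := {z | z.1 ≤ z.2} with hAdef
  have hA : MeasurableSet A := measurableSet_le measurable_fst measurable_snd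
  have hA' : MeasurableSet {z : ℝ × ℝ | z.1 < z.2} := measurableSet_lt measurable_fst measurable_snd
  have hsplit : ∫ z, φ z ∂(ν.prod ν) =
      ∫ z, A.indicator φ z ∂(ν.prod ν) + ∫ z, Aᶜ.indicator φ z ∂(ν.prod ν) := by
    rw [← integral_add (hφint.indicator hA) (hφint.indicator hA.compl)]
    exact integral_congr_ae (Eventually.of_forall fun z =>
      (congrFun (Set.indicator_self_add_compl A φ) z).symm)
  have hswap : ∫ z, Aᶜ.indicator φ z ∂(ν.prod ν) =
      ∫ z, {z : ℝ × ℝ | z.1 < z.2}.indicator φ z ∂(ν.prod ν) := by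
    rw [← integral_prod_swap]
    refine integral_congr_ae (Eventually.of_forall fun z => ?_)
    simp only [Set.indicator_apply, hAdef, mem_compl_iff, mem_ofPred_eq, Prod.fst_swap,
      Prod.snd_swap, not_le]
    split_ifs
    · simp only [hφ, Prod.fst_swap, Prod.snd_swap, mul_comm]
    · rfl
  rw [hsq, hsplit, hswap]
  have h1 := hhalf A hA fun s hs => by
    have : (Prod.mk s ⁻¹' A) ∩ Ioc 0 t = Icc s t := by
      ext r
      simp only [hAdef, mem_inter_iff, mem_preimage, mem_ofPred_eq, mem_Ioc, mem_Icc]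
      exact ⟨fun h => ⟨h.1, h.2.2⟩, fun h => ⟨h.1, hs.1.trans_le h.1, h.2⟩⟩
    rw [this]
    exact Measure.restrict_congr_set Ioc_ae_eq_Icc.symm
  have h2 := hhalf _ hA' fun s hs => by
    have : (Prod.mk s ⁻¹' {z : ℝ × ℝ | z.1 < z.2}) ∩ Ioc 0 t = Ioc s t := by
      ext r
      simp only [mem_inter_iff, mem_preimage, mem_ofPred_eq, mem_Ioc]
      exact ⟨fun h => ⟨h.1, h.2.2⟩, fun h => ⟨h.1, hs.1.trans h.1, h.2⟩⟩
    rw [this]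
  linarith

/-- The first absolute moment of a time integral, by Jensen's inequality. -/
lemma IsMarkovChain.lintegral_enorm_le [IsProbabilityMeasure P] (hX : IsMarkovChain T Q μ P X)
    {t : ℝ} (ht : t ∈ Icc 0 T) (V : S → ℝ) {K δ : ℝ} (hK : ∀ a, |V a| ≤ K)
    (hδ : ∀ a, ∀ u ∈ Icc 0 t, |∫ s in (0 : ℝ)..u, (NormedSpace.exp (s • Q) *ᵥ V) a| ≤ δ) :
    ∫⁻ w, ‖∫ s in (0 : ℝ)..t, V (X s w)‖ₑ ∂P ≤ ENNReal.ofReal (√(2 * t * K * δ)) := by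
  obtain ⟨hm, hb, hsq⟩ := hX.integral_sq_le ht V hK hδ
  set Z : Ω → ℝ := fun w => ∫ s in (0 : ℝ)..t, V (X s w)
  have hZ : Integrable Z P := Integrable.of_bound hm (K * t) (Eventually.of_forall hb)
  have hZ2 : Integrable (fun w => Z w ^ 2) P :=
    Integrable.of_bound (hm.pow 2) ((K * t) ^ 2) (Eventually.of_forall fun w => by
      rw [norm_pow]; exact pow_le_pow_left₀ (norm_nonneg _) (hb w) 2)
  rw [← ofReal_integral_norm_eq_lintegral_enorm hZ]
  refine ENNReal.ofReal_le_ofReal (Real.le_sqrt_of_sq_le (le_trans ?_ hsq))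
  set m := ∫ w, ‖Z w‖ ∂P with hmdef
  -- expand `0 ≤ E (|Z| - E|Z|)²`
  have h0 : 0 ≤ ∫ w, (Z w ^ 2 - 2 * m * ‖Z w‖ + m ^ 2) ∂P :=
    integral_nonneg fun w => by
      have : Z w ^ 2 = ‖Z w‖ ^ 2 := (sq_abs _).symm
      simp only [this, Pi.zero_apply]
      nlinarith [sq_nonneg (‖Z w‖ - m)]
  have hi : Integrable (fun w => 2 * m * ‖Z w‖) P := hZ.norm.const_mul _
  rw [integral_add (f := fun w => Z w ^ 2 - 2 * m * ‖Z w‖) (hZ2.sub hi) (integrable_const _),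
    integral_sub hZ2 hi, integral_const_mul, ← hmdef] at h0
  simp only [integral_const, probReal_univ, smul_eq_mul, one_mul] at h0
  linarith

end MarkovChain

/-! ### Occupation times of the exclusion process -/

section Generator

open scoped Matrix

lemma summable_c₂ : Summable fun z : ℤ => if z = 0 then (0 : ℝ) else 1 / |(z : ℝ)| ^ 3 := by
  have h : Summable fun z : ℤ => |1 / (z : ℝ) ^ 3| :=
    (Real.summable_one_div_int_pow (p := 3).2 (by norm_num)).abs
  refine h.of_nonneg_of_le (fun z => by split_ifs <;> positivity) fun z => ?_
  split_ifs
  · positivity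
  · rw [abs_div, abs_one, abs_pow]

lemma c₂_pos : 0 < c₂ := by
  refine inv_pos.2 (summable_c₂.tsum_pos (fun z => by split_ifs <;> positivity) 1 (by norm_num))

lemma jumpLaw_nonneg (z : ℤ) : 0 ≤ jumpLaw z := by
  have := c₂_pos
  unfold jumpLaw
  split_ifs <;> positivity

lemma jumpLaw_neg (z : ℤ) : jumpLaw (-z) = jumpLaw z := by
  simp [jumpLaw]

lemma jumpLaw_sub_comm (x y : ℤ) : jumpLaw (x - y) = jumpLaw (y - x) := by
  rw [← jumpLaw_neg, neg_sub]

variable {N : ℕ}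

/-- The total jump rate from `x` into the left reservoir. -/
noncomputable def leftTail (x : Site N) : ℝ := ∑' y : Set.Iic (0 : ℤ), jumpLaw ((x : ℤ) - (y : ℤ))

/-- The total jump rate from `x` into the right reservoir. -/
noncomputable def rightTail (x : Site N) : ℝ := ∑' y : Set.Ici (N : ℤ), jumpLaw ((x : ℤ) - (y : ℤ))

lemma leftTail_nonneg (x : Site N) : 0 ≤ leftTail x := tsum_nonneg fun _ => jumpLaw_nonneg _

lemma rightTail_nonneg (x : Site N) : 0 ≤ rightTail x := tsum_nonneg fun _ => jumpLaw_nonneg _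

lemma genLeft_eq (α κ θ : ℝ) (f : Config N → ℝ) (η : Config N) :
    genLeft α κ θ f η = kappaN κ θ N / (N : ℝ) ^ θ *
      ∑ x : Site N, leftTail x * flipRate α x η * (f (flipAt x η) - f η) := by
  simp only [genLeft, leftTail, tsum_mul_right]

lemma genRight_eq (β κ θ : ℝ) (f : Config N → ℝ) (η : Config N) :
    genRight β κ θ f η = kappaN κ θ N / (N : ℝ) ^ θ *
      ∑ x : Site N, rightTail x * flipRate β x η * (f (flipAt x η) - f η) := by
  simp only [genRight, rightTail, tsum_mul_right]

/-- The generator at `η` as a linear functional of the test function. -/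
noncomputable def genFunctional (α β κ θ : ℝ) (η : Config N) : (Config N → ℝ) →ₗ[ℝ] ℝ where
  toFun f := gen α β κ θ f η
  map_add' f g := by
    simp only [gen, genBulk, genLeft_eq, genRight_eq, Pi.add_apply, add_sub_add_comm, mul_add,
      Finset.sum_add_distrib]
    ring
  map_smul' c f := by
    have h : ∀ r a b : ℝ, r * (c * a - c * b) = c * (r * (a - b)) := fun _ _ _ => by ring
    simp only [gen, genBulk, genLeft_eq, genRight_eq, Pi.smul_apply, smul_eq_mul, h,
      ← Finset.mul_sum, RingHom.id_apply]
    ring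

lemma rateMatrix_mulVec (α β κ θ : ℝ) (f : Config N → ℝ) (η : Config N) :
    (rateMatrix N α β κ θ *ᵥ f) η = timeScale θ N * gen α β κ θ f η := by
  have h := LinearMap.pi_apply_eq_sum_univ (genFunctional α β κ θ η) f
  have h' : gen α β κ θ f η = ∑ ξ, f ξ * gen α β κ θ (Pi.single ξ 1) η := by
    refine h.trans (Finset.sum_congr rfl fun ξ _ => ?_)
    have : (fun j => if ξ = j then (1 : ℝ) else 0) = Pi.single ξ 1 := by
      funext j; simp [Pi.single_apply, eq_comm]
    rw [this]; rfl
  rw [h', Finset.mul_sum, Matrix.mulVec, dotProduct]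
  refine Finset.sum_congr rfl fun ξ _ => ?_
  simp only [rateMatrix, Matrix.of_apply]
  ring

lemma occ_nonneg (η : Config N) (x : Site N) : 0 ≤ occ η x := by
  unfold occ; split_ifs <;> norm_num

lemma occ_le_one (η : Config N) (x : Site N) : occ η x ≤ 1 := by
  unfold occ; split_ifs <;> norm_num

lemma flipRate_nonneg {δ : ℝ} (hδ : δ ∈ Icc (0 : ℝ) 1) (x : Site N) (η : Config N) :
    0 ≤ flipRate δ x η := by
  have := occ_nonneg η x
  have := occ_le_one η x
  exact add_nonneg (mul_nonneg (by linarith) (by linarith [hδ.2]))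
    (mul_nonneg (by linarith) hδ.1)

lemma kappaN_nonneg {κ : ℝ} (hκ : 0 < κ) (θ : ℝ) (N : ℕ) : 0 ≤ kappaN κ θ N := by
  have := Real.log_natCast_nonneg N
  unfold kappaN
  split_ifs <;> positivity

lemma timeScale_nonneg (θ : ℝ) (N : ℕ) : 0 ≤ timeScale θ N := by
  have := Real.log_natCast_nonneg N
  unfold timeScale
  split_ifs <;> positivity

lemma rateMatrix_nonneg_of_ne {α β κ : ℝ} (hα : α ∈ Icc (0 : ℝ) 1) (hβ : β ∈ Icc (0 : ℝ) 1)
    (hκ : 0 < κ) (θ : ℝ) (η ξ : Config N) (h : η ≠ ξ) : 0 ≤ rateMatrix N α β κ θ η ξ := by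
  have hs : ∀ ζ : Config N, 0 ≤ (Pi.single ξ (1 : ℝ) : Config N → ℝ) ζ -
      (Pi.single ξ (1 : ℝ) : Config N → ℝ) η := fun ζ => by
    rw [Pi.single_eq_of_ne h, sub_zero, Pi.single_apply]
    split_ifs <;> norm_num
  have hk := kappaN_nonneg hκ θ N
  have hk' : 0 ≤ kappaN κ θ N / (N : ℝ) ^ θ := by positivity
  refine mul_nonneg (timeScale_nonneg θ N) (add_nonneg (add_nonneg ?_ ?_) ?_)
  · exact mul_nonneg (by norm_num) (Finset.sum_nonneg fun x _ => Finset.sum_nonneg fun y _ =>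
      mul_nonneg (jumpLaw_nonneg _) (hs _))
  · rw [genLeft_eq]
    exact mul_nonneg hk' (Finset.sum_nonneg fun x _ =>
      mul_nonneg (mul_nonneg (leftTail_nonneg x) (flipRate_nonneg hα x η)) (hs _))
  · rw [genRight_eq]
    exact mul_nonneg hk' (Finset.sum_nonneg fun x _ =>
      mul_nonneg (mul_nonneg (rightTail_nonneg x) (flipRate_nonneg hβ x η)) (hs _))

lemma rateMatrix_mulVec_one (α β κ θ : ℝ) : rateMatrix N α β κ θ *ᵥ 1 = 0 := by
  funext η
  rw [rateMatrix_mulVec]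
  simp [gen, genBulk, genLeft_eq, genRight_eq]

lemma genBulk_occ (x : Site N) (η : Config N) :
    genBulk (fun ξ => occ ξ x) η =
      ∑ y : Site N, jumpLaw ((x : ℤ) - (y : ℤ)) * (occ η y - occ η x) := by
  -- only the exchanges that involve `x` change `η(x)`
  have hterm : ∀ a b : Site N, jumpLaw ((a : ℤ) - (b : ℤ)) *
      (occ (exchange a b η) x - occ η x) =
      (if a = x then jumpLaw ((a : ℤ) - (b : ℤ)) * (occ η b - occ η x) else 0) +
      (if b = x then jumpLaw ((a : ℤ) - (b : ℤ)) * (occ η a - occ η x) else 0) := by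
    intro a b
    have he : occ (exchange a b η) x = occ η (Equiv.swap a b x) := rfl
    rw [he]
    by_cases ha : a = x
    · subst ha
      by_cases hb : b = a
      · subst hb; simp
      · simp [hb]
    · by_cases hb : b = x
      · subst hb; simp [ha]
      · rw [Equiv.swap_apply_of_ne_of_ne (Ne.symm ha) (Ne.symm hb)]
        simp [ha, hb]
  simp only [genBulk, hterm, Finset.sum_add_distrib]
  have h1 : ∑ a : Site N, ∑ b : Site N,
      (if a = x then jumpLaw ((a : ℤ) - (b : ℤ)) * (occ η b - occ η x) else 0) =
      ∑ y : Site N, jumpLaw ((x : ℤ) - (y : ℤ)) * (occ η y - occ η x) := by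
    rw [Finset.sum_comm]
    exact Finset.sum_congr rfl fun b _ => by simp
  have h2 : ∑ a : Site N, ∑ b : Site N,
      (if b = x then jumpLaw ((a : ℤ) - (b : ℤ)) * (occ η a - occ η x) else 0) =
      ∑ y : Site N, jumpLaw ((x : ℤ) - (y : ℤ)) * (occ η y - occ η x) :=
    Finset.sum_congr rfl fun a _ => by simp [jumpLaw_sub_comm (a : ℤ) (x : ℤ)]
  rw [h1, h2]
  ring

lemma flipRate_mul_occ_flipAt_sub (δ : ℝ) (x y : Site N) (η : Config N) :
    flipRate δ y η * (occ (flipAt y η) x - occ η x) = if y = x then δ - occ η x else 0 := by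
  by_cases h : y = x
  · subst h
    cases hη : η y <;> simp [flipRate, flipAt, occ, hη]
  · simp [h, flipAt, occ, Function.update_of_ne (Ne.symm h)]

/-- The occupation numbers satisfy a closed linear system under the generator. -/
lemma gen_occ (α β κ θ : ℝ) (x : Site N) (η : Config N) :
    gen α β κ θ (fun ξ => occ ξ x) η =
      ∑ y : Site N, jumpLaw ((x : ℤ) - (y : ℤ)) * (occ η y - occ η x) +
        kappaN κ θ N / (N : ℝ) ^ θ *
          (leftTail x * (α - occ η x) + rightTail x * (β - occ η x)) := by
  simp only [gen, genBulk_occ, genLeft_eq, genRight_eq, mul_assoc, flipRate_mul_occ_flipAt_sub,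
    mul_ite, mul_zero, Finset.sum_ite_eq', Finset.mem_univ, if_true]
  ring

/-- The occupation time functional `f ↦ ∫₀ᵁ (e^{sQ} f)(η) ds`. -/
noncomputable def occTime {S : Type*} [Fintype S] [DecidableEq S] (Q : Matrix S S ℝ) (U : ℝ) (η : S) :
    (S → ℝ) →ₗ[ℝ] ℝ where
  toFun f := ∫ s in (0 : ℝ)..U, (NormedSpace.exp (s • Q) *ᵥ f) η
  map_add' f g := by
    simp only [Matrix.mulVec_add, Pi.add_apply]
    exact intervalIntegral.integral_add
      ((continuous_exp_smul_mulVec Q f η).intervalIntegrable _ _)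
      ((continuous_exp_smul_mulVec Q g η).intervalIntegrable _ _)
  map_smul' c f := by
    simp only [Matrix.mulVec_smul, Pi.smul_apply, smul_eq_mul, RingHom.id_apply]
    exact intervalIntegral.integral_const_mul _ _

lemma occTime_mem_Icc {S : Type*} [Fintype S] [DecidableEq S] {Q : Matrix S S ℝ}
    (hQ : ∀ i j, i ≠ j → 0 ≤ Q i j) (hQ1 : Q *ᵥ 1 = 0) {U : ℝ} (hU : 0 ≤ U) {g : S → ℝ}
    (hg : ∀ η, g η ∈ Icc (0 : ℝ) 1) (η : S) : occTime Q U η g ∈ Icc 0 U := by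
  refine ⟨intervalIntegral.integral_nonneg hU fun s hs =>
    (exp_smul_mulVec_mem_Icc hQ hQ1 hs.1 hg η).1, ?_⟩
  have := intervalIntegral.integral_mono_on hU
    ((continuous_exp_smul_mulVec Q g η).intervalIntegrable 0 U)
    (intervalIntegrable_const (c := (1 : ℝ)) (μ := volume)) fun s hs =>
      (exp_smul_mulVec_mem_Icc hQ hQ1 hs.1 hg η).2
  rw [intervalIntegral.integral_const, smul_eq_mul, mul_one, sub_zero] at this
  exact this

lemma occTime_one {S : Type*} [Fintype S] [DecidableEq S] {Q : Matrix S S ℝ}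
    (hQ1 : Q *ᵥ 1 = 0) (U : ℝ) (η : S) : occTime Q U η 1 = U := by
  simp [occTime, exp_smul_mulVec_one hQ1]

/-- The expected occupation time of a site solves a discrete elliptic equation. -/
lemma occTime_occ_eq (α β κ θ U : ℝ) (η : Config N) (x : Site N) :
    let Q := rateMatrix N α β κ θ
    let u : Site N → ℝ := fun y => occTime Q U η fun ξ => occ ξ y
    (NormedSpace.exp (U • Q) *ᵥ fun ξ => occ ξ x) η - occ η x =
      timeScale θ N * (∑ y : Site N, jumpLaw ((x : ℤ) - (y : ℤ)) * (u y - u x) +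
        kappaN κ θ N / (N : ℝ) ^ θ *
          (leftTail x * (α * U - u x) + rightTail x * (β * U - u x))) := by
  intro Q u
  have h1 : Q *ᵥ (fun ξ => occ ξ x) = timeScale θ N •
      (∑ y : Site N, jumpLaw ((x : ℤ) - (y : ℤ)) • ((fun ξ => occ ξ y) - fun ξ => occ ξ x) +
        (kappaN κ θ N / (N : ℝ) ^ θ) •
          (leftTail x • (α • (1 : Config N → ℝ) - fun ξ => occ ξ x) +
            rightTail x • (β • (1 : Config N → ℝ) - fun ξ => occ ξ x))) := by
    funext ζ
    rw [rateMatrix_mulVec, gen_occ]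
    simp [mul_add]
  have h2 := integral_exp_smul_mulVec Q (fun ξ => occ ξ x) η U
  have h3 : occTime Q U η (Q *ᵥ fun ξ => occ ξ x) =
      (NormedSpace.exp (U • Q) *ᵥ fun ξ => occ ξ x) η - occ η x := h2
  rw [← h3, h1]
  simp only [map_smul, map_add, map_sub, map_sum, smul_eq_mul,
    occTime_one (rateMatrix_mulVec_one α β κ θ) U η, Q]
  rfl

lemma sum_mul_sum_sub {ι : Type*} [Fintype ι] (p : ι → ι → ℝ) (hp : ∀ x y, p x y = p y x)
    (u : ι → ℝ) :
    ∑ x, u x * ∑ y, p x y * (u y - u x) = -(1 / 2) * ∑ x, ∑ y, p x y * (u x - u y) ^ 2 := by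
  have h1 : ∑ x, u x * ∑ y, p x y * (u y - u x) = ∑ x, ∑ y, p x y * (u x * (u y - u x)) := by
    refine Finset.sum_congr rfl fun x _ => ?_
    rw [Finset.mul_sum]
    exact Finset.sum_congr rfl fun y _ => by ring
  have h2 : ∑ x, ∑ y, p x y * (u x * (u y - u x)) = ∑ x, ∑ y, p x y * (u y * (u x - u y)) := by
    rw [Finset.sum_comm]
    exact Finset.sum_congr rfl fun x _ => Finset.sum_congr rfl fun y _ => by rw [hp]
  have h3 : ∑ x, ∑ y, p x y * (u x * (u y - u x)) + ∑ x, ∑ y, p x y * (u y * (u x - u y)) =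
      -∑ x, ∑ y, p x y * (u x - u y) ^ 2 := by
    rw [← Finset.sum_add_distrib, ← Finset.sum_neg_distrib]
    refine Finset.sum_congr rfl fun x _ => ?_
    rw [← Finset.sum_add_distrib, ← Finset.sum_neg_distrib]
    exact Finset.sum_congr rfl fun y _ => by ring
  linarith

lemma card_site_le (N : ℕ) : ((Finset.univ : Finset (Site N)).card : ℝ) ≤ N := by
  rw [Finset.card_univ, Fintype.card_coe, Int.card_Ioo]
  have : ((N : ℤ) - 0 - 1).toNat ≤ N := by omega
  exact_mod_cast this

/-- The energy estimate: test the elliptic equation for the occupation times against itself. -/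
lemma energy_occTime_le {α β κ : ℝ} (hα : α ∈ Icc (0 : ℝ) 1) (hβ : β ∈ Icc (0 : ℝ) 1)
    (hκ : 0 < κ) (θ : ℝ) {U : ℝ} (hU : 0 ≤ U) (η : Config N) :
    let u : Site N → ℝ := fun y => occTime (rateMatrix N α β κ θ) U η fun ξ => occ ξ y
    timeScale θ N * ∑ x : Site N, ∑ y : Site N, jumpLaw ((x : ℤ) - (y : ℤ)) * (u x - u y) ^ 2 ≤
      2 * (N * U) + 2 * timeScale θ N * (kappaN κ θ N / (N : ℝ) ^ θ) * U ^ 2 *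
        ∑ x : Site N, (leftTail x + rightTail x) := by
  intro u
  have hQ := rateMatrix_nonneg_of_ne hα hβ hκ θ (N := N)
  have hQ1 := rateMatrix_mulVec_one (N := N) α β κ θ
  have hocc : ∀ (x : Site N) (ξ : Config N), occ ξ x ∈ Icc (0 : ℝ) 1 :=
    fun x ξ => ⟨occ_nonneg ξ x, occ_le_one ξ x⟩
  have hu : ∀ x, u x ∈ Icc 0 U := fun x => occTime_mem_Icc hQ hQ1 hU (hocc x) η
  set Θ := timeScale θ N with hΘ
  have hΘ0 : 0 ≤ Θ := timeScale_nonneg θ N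
  set k := kappaN κ θ N / (N : ℝ) ^ θ with hk
  have hk0 : 0 ≤ k := by
    have := kappaN_nonneg hκ θ N
    positivity
  set E := ∑ x : Site N, ∑ y : Site N, jumpLaw ((x : ℤ) - (y : ℤ)) * (u x - u y) ^ 2 with hE
  have hsum : ∑ x : Site N, u x * ((NormedSpace.exp (U • rateMatrix N α β κ θ) *ᵥ
      fun ξ => occ ξ x) η - occ η x) = Θ * (-(1 / 2) * E) + Θ * k *
        ∑ x : Site N, (leftTail x * (u x * (α * U - u x)) +
          rightTail x * (u x * (β * U - u x))) := by
    rw [hE, ← sum_mul_sum_sub (fun x y : Site N => jumpLaw ((x : ℤ) - (y : ℤ)))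
      (fun x y => jumpLaw_sub_comm _ _) u, Finset.mul_sum, Finset.mul_sum,
      ← Finset.sum_add_distrib]
    refine Finset.sum_congr rfl fun x _ => ?_
    rw [occTime_occ_eq α β κ θ U η x]
    ring
  have hlow : -(N * U) ≤ ∑ x : Site N, u x * ((NormedSpace.exp (U • rateMatrix N α β κ θ) *ᵥ
      fun ξ => occ ξ x) η - occ η x) := by
    have h1 : ∑ _x : Site N, -U ≤ ∑ x : Site N, u x *
        ((NormedSpace.exp (U • rateMatrix N α β κ θ) *ᵥ fun ξ => occ ξ x) η - occ η x) := by
      refine Finset.sum_le_sum fun x _ => ?_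
      have h2 := (exp_smul_mulVec_mem_Icc hQ hQ1 hU (hocc x) η).1
      have h3 := (hocc x η).2
      obtain ⟨h4, h5⟩ := hu x
      nlinarith
    refine le_trans ?_ h1
    rw [Finset.sum_const, nsmul_eq_mul, mul_neg]
    exact neg_le_neg (mul_le_mul_of_nonneg_right (card_site_le N) hU)
  have hup : ∑ x : Site N, (leftTail x * (u x * (α * U - u x)) +
      rightTail x * (u x * (β * U - u x))) ≤
      U ^ 2 * ∑ x : Site N, (leftTail x + rightTail x) := by
    rw [Finset.mul_sum]
    refine Finset.sum_le_sum fun x _ => ?_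
    have hb : ∀ δ ∈ Icc (0 : ℝ) 1, u x * (δ * U - u x) ≤ U ^ 2 := fun δ hδ => by
      obtain ⟨h4, h5⟩ := hu x
      have : δ * U ≤ U := by nlinarith [hδ.2]
      nlinarith
    have h1 := mul_le_mul_of_nonneg_left (hb α hα) (leftTail_nonneg x)
    have h2 := mul_le_mul_of_nonneg_left (hb β hβ) (rightTail_nonneg x)
    linarith
  have h3 := mul_le_mul_of_nonneg_left hup (mul_nonneg hΘ0 hk0)
  linarith

end Generator

/-! ### Jump tails and boundary coordinates -/

section Tails

/-- Comparison of a tail sum with a telescoping series. -/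
lemma tsum_le_of_le_sub {f g : ℕ → ℝ} (hf : ∀ k, 0 ≤ f k) (hg : ∀ k, 0 ≤ g k)
    (h : ∀ k, f k ≤ g k - g (k + 1)) : ∑' k, f k ≤ g 0 := by
  refine Real.tsum_le_of_sum_range_le hf fun n => ?_
  have := Finset.sum_le_sum (s := Finset.range n) fun k _ => h k
  rw [Finset.sum_range_sub'] at this
  linarith [hg n]

lemma one_div_sq_le_sub {a : ℝ} (ha : 1 ≤ a) : 1 / a ^ 2 ≤ 2 / a - 2 / (a + 1) := by
  have : 2 / a - 2 / (a + 1) - 1 / a ^ 2 = (a - 1) / (a ^ 2 * (a + 1)) := by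
    field_simp
    ring
  have h2 : 0 ≤ (a - 1) / (a ^ 2 * (a + 1)) := by
    have : 0 ≤ a - 1 := by linarith
    positivity
  linarith

lemma one_div_cube_le_sub {a : ℝ} (ha : 1 ≤ a) : 1 / a ^ 3 ≤ 2 / a ^ 2 - 2 / (a + 1) ^ 2 := by
  have : 2 / a ^ 2 - 2 / (a + 1) ^ 2 - 1 / a ^ 3 = (3 * a ^ 2 - 1) / (a ^ 3 * (a + 1) ^ 2) := by
    field_simp
    ring
  have h2 : 0 ≤ (3 * a ^ 2 - 1) / (a ^ 3 * (a + 1) ^ 2) := by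
    have : 0 ≤ 3 * a ^ 2 - 1 := by nlinarith
    positivity
  linarith

lemma tsum_jumpLaw_le {m : ℤ} (hm : 1 ≤ m) : ∑' k : ℕ, jumpLaw (m + k) ≤ 2 * c₂ / (m : ℝ) ^ 2 := by
  have hc := c₂_pos
  have hm' : (1 : ℝ) ≤ m := by exact_mod_cast hm
  have h := tsum_le_of_le_sub (f := fun k : ℕ => jumpLaw (m + k))
    (g := fun k : ℕ => c₂ * (2 / ((m : ℝ) + k) ^ 2)) (fun k => jumpLaw_nonneg _)
    (fun k => by positivity) fun k => by
      have hk : (1 : ℝ) ≤ m + k := by linarith [(Nat.cast_nonneg k : (0 : ℝ) ≤ k)]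
      have h1 := mul_le_mul_of_nonneg_left (one_div_cube_le_sub hk) hc.le
      have h2 : jumpLaw (m + k) = c₂ * (1 / ((m : ℝ) + k) ^ 3) := by
        rw [jumpLaw, if_neg (by omega)]
        push_cast
        rw [abs_of_pos (by linarith)]
        ring
      rw [h2]
      refine h1.trans_eq ?_
      push_cast
      ring
  refine h.trans_eq ?_
  simp
  ring

lemma tsum_mul_jumpLaw_le {m : ℤ} (hm : 1 ≤ m) :
    ∑' k : ℕ, ((m : ℝ) + k) * jumpLaw (m + k) ≤ 2 * c₂ / m := by
  have hc := c₂_pos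
  have hm' : (1 : ℝ) ≤ m := by exact_mod_cast hm
  have hk : ∀ k : ℕ, (1 : ℝ) ≤ m + k := fun k => by
    linarith [(Nat.cast_nonneg k : (0 : ℝ) ≤ k)]
  have h := tsum_le_of_le_sub (f := fun k : ℕ => ((m : ℝ) + k) * jumpLaw (m + k))
    (g := fun k : ℕ => c₂ * (2 / ((m : ℝ) + k)))
    (fun k => mul_nonneg (by linarith [hk k]) (jumpLaw_nonneg _))
    (fun k => mul_nonneg hc.le (div_nonneg (by norm_num) (by linarith [hk k]))) fun k => by
      have h1 := mul_le_mul_of_nonneg_left (one_div_sq_le_sub (hk k)) hc.le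
      have h2 : ((m : ℝ) + k) * jumpLaw (m + k) = c₂ * (1 / ((m : ℝ) + k) ^ 2) := by
        rw [jumpLaw, if_neg (by omega)]
        push_cast
        have := hk k
        rw [abs_of_pos (by linarith)]
        have : (m : ℝ) + k ≠ 0 := by linarith
        field_simp
      rw [h2]
      refine h1.trans_eq ?_
      push_cast
      ring
  refine h.trans_eq ?_
  simp
  ring

/-- The half-line `[a, ∞)` in `ℤ`, parametrized from its end point. -/
def natEquivIci (a : ℤ) : ℕ ≃ Set.Ici a where
  toFun k := ⟨a + k, by simp⟩
  invFun y := (y.1 - a).toNat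
  left_inv k := by simp
  right_inv y := by
    have : a ≤ y.1 := y.2
    ext
    simp
    omega

/-- The half-line `(-∞, a]` in `ℤ`, parametrized from its end point. -/
def natEquivIic (a : ℤ) : ℕ ≃ Set.Iic a where
  toFun k := ⟨a - k, by simp⟩
  invFun y := (a - y.1).toNat
  left_inv k := by simp
  right_inv y := by
    have : y.1 ≤ a := y.2
    ext
    simp
    omega

lemma tsum_Ici_eq (a : ℤ) (f : ℤ → ℝ) : ∑' y : Set.Ici a, f y = ∑' k : ℕ, f (a + k) :=
  ((natEquivIci a).tsum_eq fun y : Set.Ici a => f y).symm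

lemma tsum_Iic_eq (a : ℤ) (f : ℤ → ℝ) : ∑' y : Set.Iic a, f y = ∑' k : ℕ, f (a - k) :=
  ((natEquivIic a).tsum_eq fun y : Set.Iic a => f y).symm

variable {N : ℕ}

lemma site_pos (x : Site N) : 1 ≤ (x : ℤ) := (Finset.mem_Ioo.1 x.2).1

lemma site_lt (x : Site N) : (x : ℤ) < N := (Finset.mem_Ioo.1 x.2).2

lemma leftTail_le (x : Site N) : leftTail x ≤ 2 * c₂ / (x : ℤ) ^ 2 := by
  refine le_trans (le_of_eq ?_) (tsum_jumpLaw_le (site_pos x))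
  rw [leftTail, tsum_Iic_eq 0 fun y => jumpLaw ((x : ℤ) - y)]
  exact tsum_congr fun k => by congr 1; ring

lemma rightTail_le (x : Site N) : rightTail x ≤ 2 * c₂ / ((N : ℝ) - (x : ℤ)) ^ 2 := by
  have := site_lt x
  refine le_trans (le_of_eq ?_) ((tsum_jumpLaw_le (m := N - x) (by omega)).trans_eq ?_)
  · rw [rightTail, tsum_Ici_eq N fun y => jumpLaw ((x : ℤ) - y)]
    exact tsum_congr fun k => by rw [jumpLaw_sub_comm]; congr 1; ring
  · push_cast; rfl

lemma rMinus_nonneg (x : Site N) : 0 ≤ rMinus x := tsum_nonneg fun _ => jumpLaw_nonneg _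

lemma rPlus_nonneg (x : Site N) : 0 ≤ rPlus x := tsum_nonneg fun _ => jumpLaw_nonneg _

lemma rMinus_le (x : Site N) : rMinus x ≤ 2 * c₂ / (x : ℤ) ^ 2 := by
  refine le_trans (le_of_eq ?_) (tsum_jumpLaw_le (site_pos x))
  rw [rMinus, tsum_Ici_eq x jumpLaw]

lemma rPlus_le (x : Site N) : rPlus x ≤ 2 * c₂ / ((N : ℝ) - (x : ℤ)) ^ 2 := by
  have := site_lt x
  refine le_trans (le_of_eq ?_) ((tsum_jumpLaw_le (m := N - x) (by omega)).trans_eq ?_)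
  · rw [rPlus, tsum_Iic_eq _ jumpLaw]
    exact tsum_congr fun k => by rw [← jumpLaw_neg]; congr 1; ring
  · push_cast; rfl

lemma thetaMinus_nonneg (x : Site N) : 0 ≤ thetaMinus x := tsum_nonneg fun y => by
  refine mul_nonneg ?_ (jumpLaw_nonneg _)
  have h1 := site_pos x
  have h2 : (y : ℤ) ≤ 0 := y.2
  have : (0 : ℤ) ≤ (x : ℤ) - y := by omega
  exact_mod_cast this

lemma thetaPlus_nonneg (x : Site N) : 0 ≤ thetaPlus x := tsum_nonneg fun y => by
  refine mul_nonneg ?_ (jumpLaw_nonneg _)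
  have h1 := site_lt x
  have h2 : (N : ℤ) ≤ y := y.2
  have : (0 : ℤ) ≤ (y : ℤ) - x := by omega
  exact_mod_cast this

lemma thetaMinus_le (x : Site N) : thetaMinus x ≤ 2 * c₂ / (x : ℤ) := by
  refine le_trans (le_of_eq ?_) (tsum_mul_jumpLaw_le (site_pos x))
  rw [thetaMinus, tsum_Iic_eq 0 fun y => (((x : ℤ) : ℝ) - (y : ℝ)) * jumpLaw ((x : ℤ) - y)]
  exact tsum_congr fun k => by
    have : (x : ℤ) - (0 - (k : ℤ)) = x + k := by ring
    rw [this]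
    push_cast
    ring

lemma thetaPlus_le (x : Site N) : thetaPlus x ≤ 2 * c₂ / ((N : ℝ) - (x : ℤ)) := by
  have := site_lt x
  refine le_trans (le_of_eq ?_) ((tsum_mul_jumpLaw_le (m := N - x) (by omega)).trans_eq ?_)
  · rw [thetaPlus, tsum_Ici_eq N fun y => ((y : ℝ) - ((x : ℤ) : ℝ)) * jumpLaw (y - (x : ℤ))]
    exact tsum_congr fun k => by
      have : (N : ℤ) + k - x = N - x + k := by ring
      rw [this]
      push_cast
      ring
  · push_cast; rfl

end Tails

section Coordinates

variable {N : ℕ}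

/-- A labelling of the sites by `0, …, N - 2` that preserves distances: the distance to one of the
two end points of the bulk. -/
structure BoundaryLabel (N : ℕ) where
  /-- the underlying bijection -/
  toEquiv : Site N ≃ Fin (N - 1)
  abs_sub_eq : ∀ x y : Site N,
    |((toEquiv x : ℕ) : ℤ) - ((toEquiv y : ℕ) : ℤ)| = |(x : ℤ) - (y : ℤ)|

/-- The label of `x` is `x - 1`. -/
def leftLabel (N : ℕ) : BoundaryLabel N where
  toEquiv :=
    { toFun := fun x => ⟨((x : ℤ) - 1).toNat, by have := site_pos x; have := site_lt x; omega⟩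
      invFun := fun i => ⟨(i : ℕ) + 1, by have := i.2; rw [Finset.mem_Ioo]; omega⟩
      left_inv := fun x => by
        have := site_pos x
        ext
        simp
        omega
      right_inv := fun i => by ext; simp }
  abs_sub_eq x y := by
    have := site_pos x
    have := site_pos y
    simp only [Equiv.coe_fn_mk]
    congr 1
    omega

/-- The label of `x` is `N - 1 - x`. -/
def rightLabel (N : ℕ) : BoundaryLabel N where
  toEquiv :=
    { toFun := fun x => ⟨((N : ℤ) - 1 - x).toNat, by
        have := site_pos x; have := site_lt x; omega⟩
      invFun := fun i => ⟨(N : ℤ) - 1 - (i : ℕ), by have := i.2; rw [Finset.mem_Ioo]; omega⟩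
      left_inv := fun x => by
        have := site_lt x
        ext
        simp
        omega
      right_inv := fun i => by
        ext
        simp }
  abs_sub_eq x y := by
    have := site_lt x
    have := site_lt y
    simp only [Equiv.coe_fn_mk]
    rw [abs_sub_comm]
    congr 1
    omega

/-- A function on the sites, read through a labelling and extended by `0`. -/
noncomputable def BoundaryLabel.read (φ : BoundaryLabel N) (u : Site N → ℝ) (i : ℕ) : ℝ :=
  if h : i < N - 1 then u (φ.toEquiv.symm ⟨i, h⟩) else 0

lemma BoundaryLabel.read_apply (φ : BoundaryLabel N) (u : Site N → ℝ) (x : Site N) :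
    φ.read u (φ.toEquiv x) = u x := by
  simp [read]

lemma BoundaryLabel.sum_range (φ : BoundaryLabel N) (g : ℕ → ℝ) :
    ∑ i ∈ Finset.range (N - 1), g i = ∑ x : Site N, g (φ.toEquiv x) := by
  rw [← Fin.sum_univ_eq_sum_range]
  exact (Equiv.sum_comp φ.toEquiv fun i : Fin (N - 1) => g i).symm

lemma BoundaryLabel.sum_filter (φ : BoundaryLabel N) {ℓ : ℕ} (hℓ : ℓ ≤ N - 1) (g : ℕ → ℝ) :
    ∑ i ∈ Finset.range ℓ, g i =
      ∑ x ∈ Finset.univ.filter (fun x : Site N => (φ.toEquiv x : ℕ) < ℓ), g (φ.toEquiv x) := by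
  rw [Finset.sum_filter, ← φ.sum_range fun i => if i < ℓ then g i else 0, ← Finset.sum_filter]
  refine Finset.sum_congr ?_ fun _ _ => rfl
  ext i
  simp only [Finset.mem_range, Finset.mem_filter]
  omega

/-- The energy in terms of labels. -/
lemma BoundaryLabel.sum_sqIncr_le (φ : BoundaryLabel N) (M : ℕ) (u : Site N → ℝ) :
    ∑ z ∈ Finset.Icc 1 M, sqIncr (N - 1) z (φ.read u) / (z : ℝ) ^ 3 ≤
      1 / c₂ * ∑ x : Site N, ∑ y : Site N, jumpLaw ((x : ℤ) - (y : ℤ)) * (u x - u y) ^ 2 := by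
  have hc := c₂_pos
  set f := φ.read u with hf
  set n := N - 1 with hn
  set F : ℕ → ℕ → ℝ := fun i j => (f j - f i) ^ 2 / |(i : ℝ) - j| ^ 3 with hF
  have hF0 : ∀ i j, 0 ≤ F i j := fun i j => by positivity
  have hR : 1 / c₂ * ∑ x : Site N, ∑ y : Site N, jumpLaw ((x : ℤ) - (y : ℤ)) * (u x - u y) ^ 2 =
      ∑ i ∈ Finset.range n, ∑ j ∈ Finset.range n, F i j := by
    rw [φ.sum_range, Finset.mul_sum]
    refine Finset.sum_congr rfl fun x _ => ?_
    rw [φ.sum_range, Finset.mul_sum]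
    refine Finset.sum_congr rfl fun y _ => ?_
    simp only [hF, hf, φ.read_apply]
    by_cases hxy : x = y
    · subst hxy; simp
    · have hne : (x : ℤ) - y ≠ 0 := fun h => hxy (Subtype.ext (by omega))
      have h1 : |(((φ.toEquiv x : ℕ) : ℝ)) - ((φ.toEquiv y : ℕ) : ℝ)| =
          |(((x : ℤ) - (y : ℤ) : ℤ) : ℝ)| := by
        have := φ.abs_sub_eq x y
        exact_mod_cast this
      rw [h1, jumpLaw, if_neg hne]
      field_simp
      ring
  rw [hR]
  have hL : ∑ z ∈ Finset.Icc 1 M, sqIncr n z f / (z : ℝ) ^ 3 =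
      ∑ i ∈ Finset.range n, ∑ z ∈ (Finset.Icc 1 M).filter (fun z => i + z < n), F i (i + z) := by
    simp only [Finset.sum_filter]
    rw [Finset.sum_comm]
    refine Finset.sum_congr rfl fun z _ => ?_
    rw [sqIncr, Finset.sum_div, ← Finset.sum_filter]
    refine Finset.sum_congr ?_ fun i _ => ?_
    · ext i
      simp only [Finset.mem_range, Finset.mem_filter]
      omega
    · simp only [hF]
      congr 2
      push_cast
      rw [sub_add_cancel_left, abs_neg, abs_of_nonneg (Nat.cast_nonneg z)]
  rw [hL]
  refine Finset.sum_le_sum fun i _ => ?_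
  refine (Finset.sum_map _ (addLeftEmbedding i) (fun j => F i j)).symm.trans_le ?_
  refine Finset.sum_le_sum_of_subset_of_nonneg ?_ fun j _ _ => hF0 i j
  intro j hj
  simp only [Finset.mem_map, Finset.mem_filter, addLeftEmbedding_apply] at hj
  obtain ⟨z, ⟨_, hz⟩, rfl⟩ := hj
  exact Finset.mem_range.2 hz

end Coordinates

/-! ### The replacement error from a fixed starting configuration -/

section WeightSums

lemma sum_filter_le_range {n M : ℕ} (f : ℕ → ℝ) :
    ∑ i ∈ (Finset.range n).filter (fun i => M ≤ i), f i =
      ∑ j ∈ Finset.range (n - M), f (M + j) := by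
  rw [← Finset.sum_Ico_eq_sum_range]
  refine Finset.sum_congr ?_ fun _ _ => rfl
  ext i
  simp only [Finset.mem_filter, Finset.mem_range, Finset.mem_Ico]
  omega

lemma sum_tail_one_div_sq_le (n M : ℕ) :
    ∑ i ∈ (Finset.range n).filter (fun i => M ≤ i), 1 / ((i : ℝ) + 1) ^ 2 ≤ 2 / ((M : ℝ) + 1) := by
  rw [sum_filter_le_range]
  have h := Finset.sum_le_sum (s := Finset.range (n - M)) fun j _ =>
    one_div_sq_le_sub (a := ((M + j : ℕ) : ℝ) + 1) (by linarith [(M + j).cast_nonneg (α := ℝ)])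
  have e : ∀ j : ℕ, 2 / (((M + j : ℕ) : ℝ) + 1) - 2 / (((M + j : ℕ) : ℝ) + 1 + 1) =
      (fun j : ℕ => 2 / (((M + j : ℕ) : ℝ) + 1)) j -
        (fun j : ℕ => 2 / (((M + j : ℕ) : ℝ) + 1)) (j + 1) := fun j => by
    push_cast; ring_nf
  simp only [e] at h
  rw [Finset.sum_range_sub'] at h
  refine h.trans ?_
  have : 0 ≤ 2 / (((M + (n - M) : ℕ) : ℝ) + 1) := by positivity
  simpa using this

lemma sum_one_div_sq_le (n : ℕ) : ∑ i ∈ Finset.range n, 1 / ((i : ℝ) + 1) ^ 2 ≤ 2 := by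
  simpa using sum_tail_one_div_sq_le n 0

lemma sum_tail_one_div_le {n M : ℕ} (hM : 0 < M) (hMn : M ≤ n) :
    ∑ i ∈ (Finset.range n).filter (fun i => M ≤ i), 1 / ((i : ℝ) + 1) ≤
      Real.log n - Real.log M := by
  rw [sum_filter_le_range]
  have h : ∀ j ∈ Finset.range (n - M), 1 / (((M + j : ℕ) : ℝ) + 1) ≤
      Real.log ((M + (j + 1) : ℕ) : ℝ) - Real.log ((M + j : ℕ) : ℝ) := fun j _ => by
    have h0 : (0 : ℝ) < ((M + j : ℕ) : ℝ) := by exact_mod_cast (by omega : 0 < M + j)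
    have h1 : (0 : ℝ) < ((M + j : ℕ) : ℝ) + 1 := by linarith
    have h2 := Real.log_le_sub_one_of_pos (div_pos h0 h1)
    rw [Real.log_div h0.ne' h1.ne'] at h2
    have h3 : ((M + j : ℕ) : ℝ) / (((M + j : ℕ) : ℝ) + 1) - 1 =
        -(1 / (((M + j : ℕ) : ℝ) + 1)) := by
      field_simp
      ring
    have h4 : ((M + (j + 1) : ℕ) : ℝ) = ((M + j : ℕ) : ℝ) + 1 := by push_cast; ring
    rw [h4]
    linarith
  refine (Finset.sum_le_sum h).trans_eq ?_
  rw [Finset.sum_range_sub fun j : ℕ => Real.log ((M + j : ℕ) : ℝ)]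
  congr 3
  omega

lemma sum_one_div_le (n : ℕ) :
    ∑ i ∈ Finset.range n, 1 / ((i : ℝ) + 1) ≤ 1 + Real.log n := by
  have h := harmonic_le_one_add_log n
  rw [harmonic] at h
  push_cast at h
  simpa using h

end WeightSums

section Labels

variable {N : ℕ}

lemma leftLabel_add_one (x : Site N) : (((leftLabel N).toEquiv x : ℕ) : ℝ) + 1 = ((x : ℤ) : ℝ) := by
  have h := site_pos x
  have : ((((leftLabel N).toEquiv x : ℕ) : ℤ)) + 1 = (x : ℤ) := by
    simp only [leftLabel, Equiv.coe_fn_mk]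
    omega
  exact_mod_cast this

lemma rightLabel_add_one (x : Site N) :
    (((rightLabel N).toEquiv x : ℕ) : ℝ) + 1 = (N : ℝ) - ((x : ℤ) : ℝ) := by
  have h := site_lt x
  have : ((((rightLabel N).toEquiv x : ℕ) : ℤ)) + 1 = (N : ℤ) - (x : ℤ) := by
    simp only [rightLabel, Equiv.coe_fn_mk]
    omega
  exact_mod_cast this

lemma sum_leftTail_add_rightTail_le (N : ℕ) :
    ∑ x : Site N, (leftTail x + rightTail x) ≤ 8 * c₂ := by
  have hc := c₂_pos
  have h : ∀ φ : BoundaryLabel N,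
      ∑ x : Site N, 2 * c₂ / ((φ.toEquiv x : ℕ) + 1 : ℝ) ^ 2 ≤ 4 * c₂ := fun φ => by
    rw [← φ.sum_range fun i => 2 * c₂ / ((i : ℝ) + 1) ^ 2]
    have := mul_le_mul_of_nonneg_left (sum_one_div_sq_le (N - 1)) (by positivity : 0 ≤ 2 * c₂)
    rw [Finset.mul_sum] at this
    simp only [mul_one_div] at this
    linarith
  rw [Finset.sum_add_distrib]
  have h1 : ∑ x : Site N, leftTail x ≤ 4 * c₂ := by
    refine le_trans (Finset.sum_le_sum fun x _ => ?_) (h (leftLabel N))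
    rw [leftLabel_add_one]
    exact leftTail_le x
  have h2 : ∑ x : Site N, rightTail x ≤ 4 * c₂ := by
    refine le_trans (Finset.sum_le_sum fun x _ => ?_) (h (rightLabel N))
    rw [rightLabel_add_one]
    exact rightTail_le x
  linarith

/-- The average of the occupation numbers over the `ℓ` sites with the smallest labels. -/
noncomputable def boxAvg (φ : BoundaryLabel N) (ℓ : ℕ) (η : Config N) : ℝ :=
  1 / (ℓ : ℝ) * ∑ x ∈ Finset.univ.filter (fun x : Site N => (φ.toEquiv x : ℕ) < ℓ), occ η x

lemma boxAvg_mem_Icc (φ : BoundaryLabel N) {ℓ : ℕ} (hℓ0 : 0 < ℓ) (hℓ : ℓ ≤ N - 1) (η : Config N) :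
    boxAvg φ ℓ η ∈ Icc (0 : ℝ) 1 := by
  have hℓ' : (0 : ℝ) < ℓ := by exact_mod_cast hℓ0
  refine ⟨mul_nonneg (by positivity) (Finset.sum_nonneg fun x _ => occ_nonneg η x), ?_⟩
  rw [boxAvg, one_div, inv_mul_le_iff₀ hℓ', mul_one]
  refine (Finset.sum_le_sum fun x _ => occ_le_one η x).trans_eq ?_
  rw [← φ.sum_filter hℓ fun _ => (1 : ℝ)]
  simp

/-- The time-integrated replacement error from a fixed starting configuration. -/
lemma abs_occTime_replacement_le (φ : BoundaryLabel N) {α β κ : ℝ} (hα : α ∈ Icc (0 : ℝ) 1)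
    (hβ : β ∈ Icc (0 : ℝ) 1) (hκ : 0 < κ) (θ : ℝ) {U : ℝ} (hU : 0 ≤ U) (η : Config N)
    {M ℓ : ℕ} (hM1 : 1 < M) (hM : M ≤ N - 1) (hℓ0 : 0 < ℓ) (hℓ : ℓ ≤ N - 1) {D : ℝ}
    (hD : 1 / c₂ * (2 * (N * U) + 2 * timeScale θ N * (kappaN κ θ N / (N : ℝ) ^ θ) * U ^ 2 *
      (8 * c₂)) ≤ timeScale θ N * D) (hΘ : 0 < timeScale θ N) (w : Site N → ℝ) :
    |occTime (rateMatrix N α β κ θ) U η fun ξ =>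
        ∑ x : Site N, w x * (occ ξ x - boxAvg φ ℓ ξ)| ≤
      (∑ x : Site N, |w x|) * (2 * √(M * D) + √(ℓ * D / Real.log M)) +
        U * ∑ x ∈ Finset.univ.filter (fun x : Site N => M ≤ (φ.toEquiv x : ℕ)), |w x| := by
  have hc := c₂_pos
  set Q := rateMatrix N α β κ θ with hQdef
  set u : Site N → ℝ := fun y => occTime Q U η fun ξ => occ ξ y with hudef
  have hu : ∀ x, u x ∈ Icc 0 U := fun x =>
    occTime_mem_Icc (rateMatrix_nonneg_of_ne hα hβ hκ θ) (rateMatrix_mulVec_one α β κ θ) hU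
      (fun ξ => ⟨occ_nonneg ξ x, occ_le_one ξ x⟩) η
  have hDE : ∑ z ∈ Finset.Icc 1 M, sqIncr (N - 1) z (φ.read u) / (z : ℝ) ^ 3 ≤ D := by
    refine (φ.sum_sqIncr_le M u).trans (le_of_mul_le_mul_left ?_ hΘ)
    refine le_trans ?_ hD
    have h1 := energy_occTime_le hα hβ hκ θ hU η
    have h2 : 2 * timeScale θ N * (kappaN κ θ N / (N : ℝ) ^ θ) * U ^ 2 *
        ∑ x : Site N, (leftTail x + rightTail x) ≤
        2 * timeScale θ N * (kappaN κ θ N / (N : ℝ) ^ θ) * U ^ 2 * (8 * c₂) := by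
      have := kappaN_nonneg hκ θ N
      exact mul_le_mul_of_nonneg_left (sum_leftTail_add_rightTail_le N) (by positivity)
    have h3 := h1.trans (add_le_add_right h2 _)
    have h4 := mul_le_mul_of_nonneg_left h3 (by positivity : 0 ≤ 1 / c₂)
    refine le_trans (le_of_eq ?_) h4
    ring
  have hfun : (fun ξ : Config N => ∑ x : Site N, w x * (occ ξ x - boxAvg φ ℓ ξ)) =
      ∑ x : Site N, w x • ((fun ξ : Config N => occ ξ x) - (1 / (ℓ : ℝ)) •
        ∑ y ∈ Finset.univ.filter (fun y : Site N => (φ.toEquiv y : ℕ) < ℓ),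
          fun ξ : Config N => occ ξ y) := by
    funext ξ
    simp [boxAvg]
  have hval : occTime Q U η (fun ξ => ∑ x : Site N, w x * (occ ξ x - boxAvg φ ℓ ξ)) =
      ∑ i ∈ Finset.range (N - 1), φ.read w i * (φ.read u i - 1 / (ℓ : ℝ) *
        ∑ j ∈ Finset.range ℓ, φ.read u j) := by
    rw [hfun, φ.sum_range, φ.sum_filter hℓ]
    simp only [map_sum, map_smul, map_sub, smul_eq_mul, φ.read_apply, hudef]
  rw [hval]
  have hmain := abs_sum_weight_mul_sub_avg_le hM1 hM hℓ0 hℓ (φ.read u) (U := U)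
    (fun i hi => by rw [BoundaryLabel.read, dif_pos hi]; exact hu _) hDE (φ.read w)
  have e1 : ∑ i ∈ Finset.range (N - 1), |φ.read w i| = ∑ x : Site N, |w x| := by
    rw [φ.sum_range]
    simp only [φ.read_apply]
  have e2 : ∑ i ∈ (Finset.range (N - 1)).filter (fun i => M ≤ i), |φ.read w i| =
      ∑ x ∈ Finset.univ.filter (fun x : Site N => M ≤ (φ.toEquiv x : ℕ)), |w x| := by
    rw [Finset.sum_filter, φ.sum_range, Finset.sum_filter]
    simp only [φ.read_apply]
  rwa [e1, e2] at hmain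

end Labels

/-! ### Asymptotics of the replacement error -/

section Asymptotics

/-- The cutoff `⌊N / (log N)²⌋`: small enough that neighbouring bonds alone control the profile up
to it, large enough that its logarithm is `(1 + o(1)) log N`. -/
noncomputable def cutoff (N : ℕ) : ℕ := ⌊(N : ℝ) / Real.log N ^ 2⌋₊

lemma tendsto_log_nat : Tendsto (fun N : ℕ => Real.log N) atTop atTop :=
  Real.tendsto_log_atTop.comp tendsto_natCast_atTop_atTop

lemma cutoff_le (N : ℕ) : (cutoff N : ℝ) ≤ N / Real.log N ^ 2 :=
  Nat.floor_le (by positivity)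

lemma tendsto_log_log_div_log :
    Tendsto (fun N : ℕ => (Real.log 2 + 2 * Real.log (Real.log N)) / Real.log N) atTop (𝓝 0) := by
  have h1 : Tendsto (fun x : ℝ => Real.log x / x) atTop (𝓝 0) :=
    Real.isLittleO_log_id_atTop.tendsto_div_nhds_zero
  have h2 := (h1.comp tendsto_log_nat).const_mul 2
  have h3 := tendsto_log_nat.const_div_atTop (Real.log 2)
  have h4 := h3.add h2
  simp only [mul_zero, add_zero] at h4
  refine h4.congr fun N => ?_
  simp only [Function.comp_apply]
  ring

lemma eventually_log_cutoff_ge :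
    ∀ᶠ N : ℕ in atTop, Real.log N - Real.log (cutoff N) ≤
      Real.log 2 + 2 * Real.log (Real.log N) := by
  have h1 : Tendsto (fun x : ℝ => x ^ 2 / Real.exp x) atTop (𝓝 0) := by
    simpa using Real.tendsto_pow_mul_exp_neg_atTop_nhds_zero 2 |>.congr fun x => by
      rw [Real.exp_neg]; rfl
  have h2 : ∀ᶠ N : ℕ in atTop, Real.log N ^ 2 / Real.exp (Real.log N) < 1 / 2 :=
    (h1.comp tendsto_log_nat).eventually_lt_const (by norm_num)
  filter_upwards [h2, tendsto_log_nat.eventually_gt_atTop 0, eventually_gt_atTop 0]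
    with N hN hlog hN0
  have hN0' : (0 : ℝ) < N := by exact_mod_cast hN0
  rw [Real.exp_log hN0', div_lt_iff₀ hN0'] at hN
  have h3 : 2 ≤ (N : ℝ) / Real.log N ^ 2 := by
    rw [le_div_iff₀ (by positivity)]
    linarith
  have h4 : (N : ℝ) / Real.log N ^ 2 < cutoff N + 1 := Nat.lt_floor_add_one _
  have h5 : (N : ℝ) / (2 * Real.log N ^ 2) ≤ cutoff N := by
    have : (N : ℝ) / (2 * Real.log N ^ 2) = (N / Real.log N ^ 2) / 2 := by
      field_simp
    rw [this]
    linarith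
  have h6 := Real.log_le_log (by positivity) h5
  rw [Real.log_div hN0'.ne' (by positivity), Real.log_mul (by norm_num) (by positivity),
    Real.log_pow] at h6
  push_cast at h6
  linarith

lemma eventually_half_log_le_log_cutoff :
    ∀ᶠ N : ℕ in atTop, Real.log N / 2 ≤ Real.log (cutoff N) := by
  filter_upwards [eventually_log_cutoff_ge, tendsto_log_nat.eventually_gt_atTop 0,
    tendsto_log_log_div_log.eventually_lt_const (by norm_num : (0 : ℝ) < 1 / 2)] with N h1 h2 h3
  rw [div_lt_iff₀ h2] at h3
  linarith

lemma eventually_one_lt_cutoff : ∀ᶠ N : ℕ in atTop, 1 < cutoff N := by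
  filter_upwards [eventually_half_log_le_log_cutoff, tendsto_log_nat.eventually_gt_atTop 0]
    with N h1 h2
  by_contra h
  have : Real.log (cutoff N) ≤ 0 :=
    Real.log_nonpos (Nat.cast_nonneg _) (by exact_mod_cast not_lt.1 h)
  linarith

lemma eventually_cutoff_le : ∀ᶠ N : ℕ in atTop, cutoff N ≤ N - 1 := by
  filter_upwards [tendsto_log_nat.eventually_ge_atTop 2, eventually_ge_atTop 2] with N h1 h2
  have h3 : (cutoff N : ℝ) < N := by
    refine (cutoff_le N).trans_lt ?_
    have hN : (0 : ℝ) < N := by exact_mod_cast (by omega : 0 < N)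
    exact div_lt_self hN (by nlinarith)
  have : cutoff N < N := by exact_mod_cast h3
  omega

lemma tendsto_cutoff : Tendsto (fun N : ℕ => (cutoff N : ℝ)) atTop atTop := by
  have h : Tendsto (fun N : ℕ => Real.log (cutoff N)) atTop atTop :=
    tendsto_atTop_mono' _ eventually_half_log_le_log_cutoff
      (tendsto_log_nat.atTop_div_const (by norm_num))
  refine tendsto_atTop_mono (fun N => ?_) h
  exact Real.log_le_self (Nat.cast_nonneg _)

/-- On the accelerated time scale the reservoirs act with total strength `O(N)`. -/
lemma kappaN_div_le {κ θ : ℝ} (hκ : 0 < κ) (hθ : 1 ≤ θ) {N : ℕ} (hN : 0 < N)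
    (hlog : 1 ≤ Real.log N) : kappaN κ θ N / (N : ℝ) ^ θ ≤ κ * Real.log N / N := by
  have hN' : (1 : ℝ) ≤ N := by exact_mod_cast hN
  have h1 : kappaN κ θ N ≤ κ * Real.log N := by
    unfold kappaN
    split_ifs
    · exact le_rfl
    · nlinarith
  have h2 : (N : ℝ) ≤ (N : ℝ) ^ θ := by
    simpa using Real.rpow_le_rpow_of_exponent_le hN' hθ
  exact div_le_div₀ (by positivity) h1 (by linarith) h2

end Asymptotics

section Replacement

/-- The replacement estimate for weights `w` whose total mass stays bounded and is asymptotically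
carried by the sites with label below the cutoff. -/
theorem tendsto_limsup_replacement
    {T : ℝ} {α β κ θ : ℝ} (hα : α ∈ Icc (0 : ℝ) 1) (hβ : β ∈ Icc (0 : ℝ) 1)
    (hκ : 0 < κ) (hθ : 1 ≤ θ)
    {μ : ∀ N : ℕ, Measure (Config N)}
    {Ω : ℕ → Type*} [∀ N : ℕ, MeasurableSpace (Ω N)]
    {P : ∀ N : ℕ, Measure (Ω N)} (hP : ∀ N : ℕ, IsProbabilityMeasure (P N))
    {X : ∀ N : ℕ, ℝ → Ω N → Config N}
    (hX : ∀ N : ℕ, 1 < N → IsMarkovChain T (rateMatrix N α β κ θ) (μ N) (P N) (X N))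
    {t : ℝ} (ht : t ∈ Icc 0 T) (φ : ∀ N : ℕ, BoundaryLabel N) (w : ∀ N : ℕ, Site N → ℝ) {W : ℝ}
    (hW : ∀ᶠ N : ℕ in atTop, ∑ x : Site N, |w N x| ≤ W)
    (htail : Tendsto (fun N : ℕ => ∑ x ∈ Finset.univ.filter
      (fun x : Site N => cutoff N ≤ ((φ N).toEquiv x : ℕ)), |w N x|) atTop (𝓝 0)) :
    Tendsto (fun ε : ℝ => limsup (fun N : ℕ =>
        ∫⁻ ω, ‖∫ s in (0 : ℝ)..t, ∑ x : Site N,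
          w N x * (occ (X N s ω) x - boxAvg (φ N) ⌊ε * N⌋₊ (X N s ω))‖ₑ ∂(P N)) atTop)
      (𝓝[>] 0) (𝓝 0) := by
  have hc := c₂_pos
  have ht0 := ht.1
  have hW0 : 0 ≤ W := by
    obtain ⟨N, hN⟩ := hW.exists
    exact (Finset.sum_nonneg fun x _ => abs_nonneg _).trans hN
  -- `C₀ log N / N` bounds the energy of the occupation times
  set C₀ : ℝ := 1 / c₂ * (2 * t + 2 * κ * t ^ 2 * (8 * c₂)) with hC₀
  have hC₀0 : 0 ≤ C₀ := by positivity
  set tail : ℕ → ℝ := fun N => ∑ x ∈ Finset.univ.filter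
      (fun x : Site N => cutoff N ≤ ((φ N).toEquiv x : ℕ)), |w N x| with htail_def
  set δ : ℝ → ℕ → ℝ := fun ε N =>
    W * (2 * √(C₀ / Real.log N) + √(2 * (ε * C₀))) + t * tail N with hδdef
  have hbound : ∀ ε ∈ Ioo (0 : ℝ) 1, ∀ᶠ N : ℕ in atTop,
      ∫⁻ ω, ‖∫ s in (0 : ℝ)..t, ∑ x : Site N,
          w N x * (occ (X N s ω) x - boxAvg (φ N) ⌊ε * N⌋₊ (X N s ω))‖ₑ ∂(P N) ≤
        ENNReal.ofReal (√(2 * t * W * δ ε N)) := by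
    intro ε hε
    filter_upwards [hW, eventually_one_lt_cutoff, eventually_cutoff_le,
      eventually_half_log_le_log_cutoff, tendsto_log_nat.eventually_ge_atTop 1,
      eventually_gt_atTop 1, (tendsto_natCast_atTop_atTop (R := ℝ)).eventually_ge_atTop (1 / ε)]
      with N hWN hM1 hM hhalf hlog hN1 hNε
    have hN0 : (0 : ℝ) < N := by exact_mod_cast (by omega : 0 < N)
    have hlog0 : 0 < Real.log N := by linarith
    have hℓ0 : 0 < ⌊ε * N⌋₊ := by
      rw [Nat.floor_pos]
      rw [div_le_iff₀ hε.1] at hNε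
      linarith
    have hℓN : (⌊ε * N⌋₊ : ℝ) ≤ ε * N := Nat.floor_le (mul_nonneg hε.1.le hN0.le)
    have hℓ : ⌊ε * N⌋₊ ≤ N - 1 := by
      have h1 : (⌊ε * N⌋₊ : ℝ) < N := hℓN.trans_lt (by nlinarith [hε.2])
      have : ⌊ε * N⌋₊ < N := by exact_mod_cast h1
      omega
    have := hP N
    have hΘ : timeScale θ N = (N : ℝ) ^ 2 / Real.log N := by
      rw [timeScale, if_neg (by linarith)]
    have hΘ0 : 0 < timeScale θ N := by rw [hΘ]; positivity
    refine (hX N hN1).lintegral_enorm_le ht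
      (fun ξ => ∑ x : Site N, w N x * (occ ξ x - boxAvg (φ N) ⌊ε * N⌋₊ ξ)) (K := W) (δ := δ ε N)
      (fun ξ => ?_) (fun ξ U hU => ?_)
    · refine (Finset.abs_sum_le_sum_abs _ _).trans (le_trans (Finset.sum_le_sum fun x _ => ?_) hWN)
      rw [abs_mul]
      have h1 := boxAvg_mem_Icc (φ N) hℓ0 hℓ ξ
      have h2 := occ_nonneg ξ x
      have h3 := occ_le_one ξ x
      refine mul_le_of_le_one_right (abs_nonneg _) ?_
      rw [abs_le]
      constructor <;> linarith [h1.1, h1.2]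
    · -- the time scale `N² / log N` turns the `O(N)` of the energy estimate into `C₀ log N / N`
      have hk := kappaN_div_le hκ hθ (by omega : 0 < N) hlog
      have hD : 1 / c₂ * (2 * (N * U) + 2 * timeScale θ N * (kappaN κ θ N / (N : ℝ) ^ θ) * U ^ 2 *
          (8 * c₂)) ≤ timeScale θ N * (C₀ * Real.log N / N) := by
        have h1 : timeScale θ N * (C₀ * Real.log N / N) = 1 / c₂ * (2 * (N * t) +
            2 * timeScale θ N * (κ * Real.log N / N) * t ^ 2 * (8 * c₂)) := by
          rw [hΘ, hC₀]
          field_simp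
        rw [h1]
        have hU0 := hU.1
        have hUt := hU.2
        have := kappaN_nonneg hκ θ N
        gcongr
      refine (abs_occTime_replacement_le (φ N) hα hβ hκ θ hU.1 ξ hM1 hM hℓ0 hℓ hD hΘ0
        (w N)).trans ?_
      have hMD : (cutoff N : ℝ) * (C₀ * Real.log N / N) ≤ C₀ / Real.log N := by
        refine (mul_le_mul_of_nonneg_right (cutoff_le N) (by positivity)).trans_eq ?_
        field_simp
      have hℓD : (⌊ε * N⌋₊ : ℝ) * (C₀ * Real.log N / N) / Real.log (cutoff N) ≤
          2 * (ε * C₀) := by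
        have h1 : (⌊ε * N⌋₊ : ℝ) * (C₀ * Real.log N / N) ≤ ε * C₀ * Real.log N := by
          refine (mul_le_mul_of_nonneg_right hℓN (by positivity)).trans_eq ?_
          field_simp
        rw [div_le_iff₀ (by linarith)]
        have h2 : 0 ≤ ε * C₀ := mul_nonneg hε.1.le hC₀0
        nlinarith
      have htail0 : 0 ≤ tail N := Finset.sum_nonneg fun x _ => abs_nonneg _
      exact add_le_add (mul_le_mul hWN (add_le_add (mul_le_mul_of_nonneg_left
        (Real.sqrt_le_sqrt hMD) (by norm_num)) (Real.sqrt_le_sqrt hℓD)) (by positivity) hW0)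
        (mul_le_mul_of_nonneg_right hU.2 htail0)
  have hδlim : ∀ ε : ℝ, Tendsto (δ ε) atTop (𝓝 (W * √(2 * (ε * C₀)))) := by
    intro ε
    have h1 : Tendsto (fun N : ℕ => √(C₀ / Real.log N)) atTop (𝓝 0) := by
      have := (Real.continuous_sqrt.tendsto 0).comp (tendsto_log_nat.const_div_atTop C₀)
      rwa [Real.sqrt_zero] at this
    have h2 := (((h1.const_mul 2).add_const (√(2 * (ε * C₀)))).const_mul W).add
      (htail.const_mul t)
    simpa only [mul_zero, zero_add, add_zero] using h2
  have hlimsup : ∀ ε ∈ Ioo (0 : ℝ) 1, limsup (fun N : ℕ =>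
        ∫⁻ ω, ‖∫ s in (0 : ℝ)..t, ∑ x : Site N,
          w N x * (occ (X N s ω) x - boxAvg (φ N) ⌊ε * N⌋₊ (X N s ω))‖ₑ ∂(P N)) atTop ≤
        ENNReal.ofReal (√(2 * t * W * (W * √(2 * (ε * C₀))))) := by
    intro ε hε
    refine (limsup_le_limsup (hbound ε hε)).trans_eq ?_
    exact (ENNReal.tendsto_ofReal ((Real.continuous_sqrt.tendsto _).comp
      ((hδlim ε).const_mul (2 * t * W)))).limsup_eq
  have hzero : Tendsto (fun ε : ℝ => ENNReal.ofReal (√(2 * t * W * (W * √(2 * (ε * C₀))))))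
      (𝓝[>] 0) (𝓝 0) := by
    have hcont : Continuous fun ε : ℝ => ENNReal.ofReal (√(2 * t * W * (W * √(2 * (ε * C₀))))) :=
      ENNReal.continuous_ofReal.comp (by fun_prop)
    have := hcont.tendsto 0
    simp only [zero_mul, mul_zero, Real.sqrt_zero, ENNReal.ofReal_zero] at this
    exact this.mono_left nhdsWithin_le_nhds
  refine tendsto_of_tendsto_of_tendsto_of_le_of_le' tendsto_const_nhds hzero
    (Eventually.of_forall fun _ => zero_le) ?_
  filter_upwards [Ioo_mem_nhdsGT (zero_lt_one (α := ℝ))] with ε hε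
  exact hlimsup ε hε

end Replacement

/-! ### The weights of the four limits -/

section Weights

lemma sum_abs_weight_sq {A : ℝ} (hA : 0 ≤ A) {φ : ∀ N : ℕ, BoundaryLabel N}
    {w : ∀ N : ℕ, Site N → ℝ}
    (hw : ∀ N x, |w N x| ≤ A * (1 / (((φ N).toEquiv x : ℕ) + 1 : ℝ) ^ 2)) :
    (∀ᶠ N : ℕ in atTop, ∑ x : Site N, |w N x| ≤ 2 * A) ∧
    Tendsto (fun N : ℕ => ∑ x ∈ Finset.univ.filter
      (fun x : Site N => cutoff N ≤ ((φ N).toEquiv x : ℕ)), |w N x|) atTop (𝓝 0) := by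
  constructor
  · refine Eventually.of_forall fun N => (Finset.sum_le_sum fun x _ => hw N x).trans ?_
    rw [← (φ N).sum_range fun i => A * (1 / ((i : ℝ) + 1) ^ 2), ← Finset.mul_sum]
    linarith [mul_le_mul_of_nonneg_left (sum_one_div_sq_le (N - 1)) hA]
  · have hlim : Tendsto (fun N : ℕ => A * (2 / ((cutoff N : ℝ) + 1))) atTop (𝓝 0) := by
      have := ((tendsto_atTop_add_const_right _ (1 : ℝ) tendsto_cutoff).const_div_atTop 2).const_mul A
      simpa only [mul_zero] using this
    refine squeeze_zero (fun N => Finset.sum_nonneg fun x _ => abs_nonneg _) (fun N => ?_) hlim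
    refine (Finset.sum_le_sum fun x _ => hw N x).trans ?_
    rw [Finset.sum_filter, ← (φ N).sum_range fun i =>
      if cutoff N ≤ i then A * (1 / ((i : ℝ) + 1) ^ 2) else 0, ← Finset.sum_filter,
      ← Finset.mul_sum]
    exact mul_le_mul_of_nonneg_left (sum_tail_one_div_sq_le (N - 1) (cutoff N)) hA

lemma sum_abs_weight_log {A : ℝ} (hA : 0 ≤ A) {φ : ∀ N : ℕ, BoundaryLabel N}
    {w : ∀ N : ℕ, Site N → ℝ}
    (hw : ∀ N x, |w N x| ≤ A / Real.log N * (1 / (((φ N).toEquiv x : ℕ) + 1 : ℝ))) :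
    (∀ᶠ N : ℕ in atTop, ∑ x : Site N, |w N x| ≤ 2 * A) ∧
    Tendsto (fun N : ℕ => ∑ x ∈ Finset.univ.filter
      (fun x : Site N => cutoff N ≤ ((φ N).toEquiv x : ℕ)), |w N x|) atTop (𝓝 0) := by
  have hlogle : ∀ N : ℕ, Real.log ((N - 1 : ℕ) : ℝ) ≤ Real.log N := fun N => by
    rcases Nat.eq_zero_or_pos (N - 1) with h | h
    · simpa [h] using Real.log_natCast_nonneg N
    · exact Real.log_le_log (by exact_mod_cast h) (by exact_mod_cast Nat.sub_le N 1)
  constructor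
  · filter_upwards [tendsto_log_nat.eventually_ge_atTop 1] with N hN
    refine (Finset.sum_le_sum fun x _ => hw N x).trans ?_
    rw [← (φ N).sum_range fun i => A / Real.log N * (1 / ((i : ℝ) + 1)), ← Finset.mul_sum]
    have h1 : ∑ i ∈ Finset.range (N - 1), 1 / ((i : ℝ) + 1) ≤ 2 * Real.log N := by
      linarith [sum_one_div_le (N - 1), hlogle N]
    refine (mul_le_mul_of_nonneg_left h1 (by positivity)).trans_eq ?_
    field_simp
  · have hlim := tendsto_log_log_div_log.const_mul A
    rw [mul_zero] at hlim
    refine squeeze_zero' (Eventually.of_forall fun N => Finset.sum_nonneg fun x _ => abs_nonneg _)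
      ?_ hlim
    filter_upwards [eventually_log_cutoff_ge, eventually_one_lt_cutoff, eventually_cutoff_le,
      tendsto_log_nat.eventually_gt_atTop 0] with N h1 h2 h3 h4
    refine (Finset.sum_le_sum fun x _ => hw N x).trans ?_
    rw [Finset.sum_filter, ← (φ N).sum_range fun i =>
      if cutoff N ≤ i then A / Real.log N * (1 / ((i : ℝ) + 1)) else 0, ← Finset.sum_filter,
      ← Finset.mul_sum]
    have h5 := sum_tail_one_div_le (by omega : 0 < cutoff N) h3
    have h6 : ∑ i ∈ (Finset.range (N - 1)).filter (fun i => cutoff N ≤ i), 1 / ((i : ℝ) + 1) ≤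
        Real.log 2 + 2 * Real.log (Real.log N) := by linarith [hlogle N]
    refine (mul_le_mul_of_nonneg_left h6 (by positivity)).trans_eq ?_
    ring

end Weights

section Averages

variable {N : ℕ}

lemma leftAvg_eq_boxAvg {ε : ℝ} (hε : 0 ≤ ε) (η : Config N) :
    leftAvg ε η = boxAvg (leftLabel N) ⌊ε * N⌋₊ η := by
  have h : (⌊ε * N⌋ : ℤ) = (⌊ε * N⌋₊ : ℤ) := (Int.natCast_floor_eq_floor (by positivity)).symm
  rw [leftAvg, boxAvg, h, Int.cast_natCast]
  congr 2
  refine Finset.filter_congr fun x _ => ?_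
  have := site_pos x
  simp only [leftLabel, Equiv.coe_fn_mk]
  omega

lemma rightAvg_eq_boxAvg {ε : ℝ} (hε : 0 ≤ ε) (η : Config N) :
    rightAvg ε η = boxAvg (rightLabel N) ⌊ε * N⌋₊ η := by
  have h : (⌊ε * N⌋ : ℤ) = (⌊ε * N⌋₊ : ℤ) := (Int.natCast_floor_eq_floor (by positivity)).symm
  rw [rightAvg, boxAvg, h, Int.cast_natCast]
  congr 2
  refine Finset.filter_congr fun x _ => ?_
  have := site_lt x
  simp only [rightLabel, Equiv.coe_fn_mk]
  omega

lemma macroPos_mem_Icc (x : Site N) : macroPos x ∈ Icc (0 : ℝ) 1 := by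
  have h1 : (1 : ℝ) ≤ ((x : ℤ) : ℝ) := by exact_mod_cast site_pos x
  have h2 : ((x : ℤ) : ℝ) < N := by exact_mod_cast site_lt x
  exact ⟨div_nonneg (by linarith) (by linarith), div_le_one_of_le₀ h2.le (by linarith)⟩

lemma abs_log_weight_le {a b B r : ℝ} (ha : |a| ≤ B) (hb0 : 0 ≤ b) (hb : b ≤ 2 * c₂ / r)
    (N : ℕ) : |1 / Real.log N * a * b| ≤ 2 * B * c₂ / Real.log N * (1 / r) := by
  have hlog := Real.log_natCast_nonneg N
  rw [abs_mul, abs_mul, abs_of_nonneg hb0, abs_of_nonneg (by positivity : 0 ≤ 1 / Real.log N)]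
  have : 1 / Real.log N * |a| * b ≤ 1 / Real.log N * B * (2 * c₂ / r) := by
    have := (abs_nonneg a).trans ha
    gcongr
  exact this.trans_eq (by ring)

lemma abs_weight_sq_le {a b B r : ℝ} (ha : |a| ≤ B) (hb0 : 0 ≤ b) (hb : b ≤ 2 * c₂ / r ^ 2) :
    |a * b| ≤ 2 * B * c₂ * (1 / r ^ 2) := by
  rw [abs_mul, abs_of_nonneg hb0]
  have : |a| * b ≤ B * (2 * c₂ / r ^ 2) := by
    have := (abs_nonneg a).trans ha
    gcongr
  exact this.trans_eq (by ring)

end Averages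

end LongJumpExclusion

theorem mainTheorem5
    (T : ℝ) (hT : 0 < T) (α β κ θ : ℝ) (hα : α ∈ Icc (0 : ℝ) 1) (hβ : β ∈ Icc (0 : ℝ) 1)
    (hκ : 0 < κ) (hθ : 1 ≤ θ)
    (μ : ∀ N : ℕ, Measure (Config N)) (hμ : ∀ N : ℕ, IsProbabilityMeasure (μ N))
    (Ω : ℕ → Type*) [∀ N : ℕ, MeasurableSpace (Ω N)]
    (P : ∀ N : ℕ, Measure (Ω N)) (hP : ∀ N : ℕ, IsProbabilityMeasure (P N))
    (X : ∀ N : ℕ, ℝ → Ω N → Config N)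
    (hX : ∀ N : ℕ, 1 < N → IsMarkovChain T (rateMatrix N α β κ θ) (μ N) (P N) (X N))
    (t : ℝ) (ht : t ∈ Icc 0 T)
    (G : ℝ → ℝ) (hG : ContDiffOn ℝ (⊤ : ℕ∞) G (Icc 0 1)) :
    -- left boundary, weights `G'(x/N) Θ_x^- / log N`
    Tendsto (fun ε : ℝ => limsup (fun N : ℕ =>
        ∫⁻ w, ‖∫ s in (0 : ℝ)..t, 1 / Real.log N * ∑ x : Site N,
          D01 G (macroPos x) * (occ (X N s w) x - leftAvg ε (X N s w)) * thetaMinus x‖ₑ ∂(P N)) atTop)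
      (𝓝[>] 0) (𝓝 0) ∧
    -- right boundary, weights `G'(x/N) Θ_x^+ / log N`
    Tendsto (fun ε : ℝ => limsup (fun N : ℕ =>
        ∫⁻ w, ‖∫ s in (0 : ℝ)..t, 1 / Real.log N * ∑ x : Site N,
          D01 G (macroPos x) * (occ (X N s w) x - rightAvg ε (X N s w)) * thetaPlus x‖ₑ ∂(P N)) atTop)
      (𝓝[>] 0) (𝓝 0) ∧
    -- left boundary, weights `G(x/N) r_N^-(x/N)`
    Tendsto (fun ε : ℝ => limsup (fun N : ℕ =>
        ∫⁻ w, ‖∫ s in (0 : ℝ)..t, ∑ x : Site N,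
          G (macroPos x) * rMinus x * (occ (X N s w) x - leftAvg ε (X N s w))‖ₑ ∂(P N)) atTop)
      (𝓝[>] 0) (𝓝 0) ∧
    -- right boundary, weights `G(x/N) r_N^+(x/N)`
    Tendsto (fun ε : ℝ => limsup (fun N : ℕ =>
        ∫⁻ w, ‖∫ s in (0 : ℝ)..t, ∑ x : Site N,
          G (macroPos x) * rPlus x * (occ (X N s w) x - rightAvg ε (X N s w))‖ₑ ∂(P N)) atTop)
      (𝓝[>] 0) (𝓝 0) := by
  obtain ⟨B, hB⟩ := isCompact_Icc.exists_bound_of_continuousOn hG.continuousOn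
  obtain ⟨B', hB'⟩ := isCompact_Icc.exists_bound_of_continuousOn
    (hG.continuousOn_derivWithin (uniqueDiffOn_Icc (zero_lt_one (α := ℝ))) (by simp))
  have hc := c₂_pos
  have hB0 : 0 ≤ B := (norm_nonneg _).trans (hB 0 (by simp))
  have hB'0 : 0 ≤ B' := (norm_nonneg _).trans (hB' 0 (by simp))
  have hG0 : ∀ (N : ℕ) (x : Site N), |G (macroPos x)| ≤ B := fun N x => hB _ (macroPos_mem_Icc x)
  have hG1 : ∀ (N : ℕ) (x : Site N), |D01 G (macroPos x)| ≤ B' := fun N x =>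
    hB' _ (macroPos_mem_Icc x)
  refine ⟨?_, ?_, ?_, ?_⟩
  · obtain ⟨h1, h2⟩ := sum_abs_weight_log (A := 2 * B' * c₂) (by positivity) (φ := leftLabel)
      (w := fun N x => 1 / Real.log N * D01 G (macroPos x) * thetaMinus x) fun N x => by
        rw [leftLabel_add_one]
        exact abs_log_weight_le (hG1 N x) (thetaMinus_nonneg x) (thetaMinus_le x) N
    refine (tendsto_limsup_replacement hα hβ hκ hθ hP hX ht leftLabel _ h1 h2).congr' ?_
    filter_upwards [self_mem_nhdsWithin] with ε hε
    simp only [leftAvg_eq_boxAvg (le_of_lt (mem_Ioi.1 hε)), Finset.mul_sum]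
    congr! 8
    ring
  · obtain ⟨h1, h2⟩ := sum_abs_weight_log (A := 2 * B' * c₂) (by positivity) (φ := rightLabel)
      (w := fun N x => 1 / Real.log N * D01 G (macroPos x) * thetaPlus x) fun N x => by
        rw [rightLabel_add_one]
        exact abs_log_weight_le (hG1 N x) (thetaPlus_nonneg x) (thetaPlus_le x) N
    refine (tendsto_limsup_replacement hα hβ hκ hθ hP hX ht rightLabel _ h1 h2).congr' ?_
    filter_upwards [self_mem_nhdsWithin] with ε hε
    simp only [rightAvg_eq_boxAvg (le_of_lt (mem_Ioi.1 hε)), Finset.mul_sum]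
    congr! 8
    ring
  · obtain ⟨h1, h2⟩ := sum_abs_weight_sq (A := 2 * B * c₂) (by positivity) (φ := leftLabel)
      (w := fun N x => G (macroPos x) * rMinus x) fun N x => by
        rw [leftLabel_add_one]
        exact abs_weight_sq_le (hG0 N x) (rMinus_nonneg x) (rMinus_le x)
    refine (tendsto_limsup_replacement hα hβ hκ hθ hP hX ht leftLabel _ h1 h2).congr' ?_
    filter_upwards [self_mem_nhdsWithin] with ε hε
    simp only [leftAvg_eq_boxAvg (le_of_lt (mem_Ioi.1 hε))]
  · obtain ⟨h1, h2⟩ := sum_abs_weight_sq (A := 2 * B * c₂) (by positivity) (φ := rightLabel)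
      (w := fun N x => G (macroPos x) * rPlus x) fun N x => by
        rw [rightLabel_add_one]
        exact abs_weight_sq_le (hG0 N x) (rPlus_nonneg x) (rPlus_le x)
    refine (tendsto_limsup_replacement hα hβ hκ hθ hP hX ht rightLabel _ h1 h2).congr' ?_
    filter_upwards [self_mem_nhdsWithin] with ε hε
    simp only [rightAvg_eq_boxAvg (le_of_lt (mem_Ioi.1 hε))]
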